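/- **Model.** Let $n\in\mathbb N$, $p\in[0,1]$, $0\le k\le n$, $q\in[0,\tfrac12]$. All directed graphs on $[n]=\{1,\dots,n\}$ are simple (at most one directed edge between two vertices) and are identified with their skew-symmetric adjacency matrix $Y\in\{0,\pm1\}^{n\times n}$, where $Y_{ij}=1$ if there is an edge from $i$ to $j$. Under the null model $\mathcal Q=\mathcal Q_n$, independently for each pair $i<j$, $Y_{ij}=0$ with probability $1-p$ and $Y_{ij}=\pm1$ with probability $p/2$ each. Under the planted model $\mathcal P=\mathcal P_n$, a random set $S\subseteq[n]$ contains each vertex independently with probability $k/n$; given $S$, a permutation $\pi$ of $S$ is chosen uniformly at random; given $(S,\pi)$, the pairs of vertices are independent: for $i,j\in S$ with $\pi(i)<\pi(j)$, there is an edge from $i$ to $j$ with probability $p(\tfrac12+q)$, an edge from $j$ to $i$ with probability $p(\tfrac12-q)$, and no edge with probability $1-p$; for every other pair there is an edge in either direction with probability $p/2$ each, and no edge with probability $1-p$. **Notions.** A sequence of tests $A_n$ with values in $\{0,1\}$ achieves *strong detection* if $\Pr_{\mathcal Q_n}[A_n(Y)=1]+\Pr_{\mathcal P_n}[A_n(Y)=0]\to0$.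 A sequence of real polynomials $f_n$ in the entries of $Y$ *weakly separates* $\mathcal Q$ from $\mathcal P$ if there is $c>0$ such that, for all sufficiently large $n$, $\mathbb E_{\mathcal P_n}f_n-\mathbb E_{\mathcal Q_n}f_n$ is positive and at least $c\,\max\{\sqrt{\mathrm{Var}_{\mathcal Q_n}f_n},\sqrt{\mathrm{Var}_{\mathcal P_n}f_n}\}$. The *low-degree advantage* is $$\mathrm{Adv}_{\le D}(\mathcal Q,\mathcal P)=\sup\Big\{\frac{\mathbb E_{\mathcal P}f(Y)}{\sqrt{\mathbb E_{\mathcal Q}f(Y)^2}}\;:\;f\in\mathbb R[Y],\ \deg f\le D,\ \mathbb E_{\mathcal Q}f(Y)^2\ne0\Big\}.$$ **Theorem (computational detection in the log-density setting).** Let $\alpha,\beta,\gamma\in(0,1)$ and let $q=n^{-\alpha}$, $k=n^{\beta}$, $p=n^{-\gamma}$. 1. If $\beta>\frac23\alpha+\frac13\gamma+\frac12$, then strong detection is possible in polynomial time, by thresholding a polynomial of degree at most $2$. Namely, for $$f_n(Y)=\sum_{i=1}^n\ \sum_{\substack{j,k\in[n]\setminus\{i\}\\ j<k}}Y_{ij}Y_{ik}$$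 there are thresholds $t_n\in\mathbb R$ such that the tests $A_n(Y)=\mathbf 1\{f_n(Y)\ge t_n\}$ achieve strong detection and are computable by a single algorithm in time polynomial in $n$. 2. If $\beta<\frac23\alpha+\frac13\gamma+\frac12$, then for every $\varepsilon>0$ and every $D=D(n)\in\mathbb N$ with $D(n)=O((\log n)^{2-\varepsilon})$ we have $\mathrm{Adv}_{\le D(n)}(\mathcal Q_n,\mathcal P_n)=1+o(1)$ as $n\to\infty$, and no sequence of polynomials $f_n$ with $\deg f_n\le D(n)$ weakly separates $\mathcal Q$ from $\mathcal P$. -/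

import Mathlib

open Filter Topology Asymptotics

noncomputable section

namespace PRS

/-! ### Digraphs, polynomials in the adjacency matrix, finite distributions -/

/-- The pairs `i < j` of vertices in `[n]`. -/
abbrev VPair (n : ℕ) : Type := {e : Fin n × Fin n // e.1 < e.2}

/-- A simple directed graph on `[n]`: to each pair `i < j` it assigns `1` (there is an edge from
`i` to `j`), `-1` (there is an edge from `j` to `i`) or `0` (there is no edge). -/
abbrev Dig (n : ℕ) : Type := VPair n → SignType

/-- The skew-symmetric adjacency matrix, with entries in `{-1, 0, 1}`. -/
def adj {n : ℕ} (Y : Dig n) (i j : Fin n) : SignType :=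
  if h : i < j then Y ⟨(i, j), h⟩ else if h : j < i then -Y ⟨(j, i), h⟩ else 0

/-- Real polynomials in the entries of an `n × n` matrix. -/
abbrev Poly (n : ℕ) : Type := MvPolynomial (Fin n × Fin n) ℝ

/-- The value `f(Y)` of a polynomial at the adjacency matrix of a digraph. -/
def value {n : ℕ} (f : Poly n) (Y : Dig n) : ℝ :=
  MvPolynomial.eval (fun e : Fin n × Fin n => ((adj Y e.1 e.2 : SignType) : ℝ)) f

/-- Expectation of `g` under the distribution with mass function `μ`. -/
def expect {n : ℕ} (μ : Dig n → ℝ) (g : Dig n → ℝ) : ℝ := ∑ Y, μ Y * g Y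

/-- Variance of `g` under the distribution with mass function `μ`. -/
def var {n : ℕ} (μ : Dig n → ℝ) (g : Dig n → ℝ) : ℝ :=
  expect μ (fun Y => (g Y - expect μ g) ^ 2)

/-- Probability that the test `A` outputs `b` (`true` stands for `1`, `false` for `0`). -/
def prob {n : ℕ} (μ : Dig n → ℝ) (A : Dig n → Bool) (b : Bool) : ℝ :=
  ∑ Y with A Y = b, μ Y

/-! ### The planted ranked subgraph model -/

/-- Law of the status of a pair `i < j`: no edge with probability `1 - p`, an edge from `i` to `j`
with probability `p (1/2 + b)`, an edge from `j` to `i` with probability `p (1/2 - b)`. -/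
def arcProb (p b : ℝ) : SignType → ℝ
  | SignType.zero => 1 - p
  | SignType.pos => p * (1 / 2 + b)
  | SignType.neg => p * (1 / 2 - b)

/-- The null model `Q`. -/
def nullProb (n : ℕ) (p : ℝ) (Y : Dig n) : ℝ := ∏ e, arcProb p 0 (Y e)

/-- Directional bias of the pair `(i, j)` given the community `S` and its ranking `π`: the edge
is biased towards going from the vertex of smaller rank to the one of larger rank. -/
def bias {n : ℕ} (q : ℝ) (S : Finset (Fin n)) (π : Equiv.Perm S) (i j : Fin n) : ℝ :=
  if h : i ∈ S ∧ j ∈ S then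
    if π ⟨i, h.1⟩ < π ⟨j, h.2⟩ then q else -q
  else 0

/-- The planted model `P`: the community `S` contains each vertex independently with
probability `k / n`; given `S`, the permutation `π` of `S` is uniform; given `S` and `π`,
the pairs of vertices are independent. -/
def plantedProb (n : ℕ) (k p q : ℝ) (Y : Dig n) : ℝ :=
  ∑ S : Finset (Fin n), (k / n) ^ S.card * (1 - k / n) ^ (n - S.card) *
    (((S.card.factorial : ℝ))⁻¹ *
      ∑ π : Equiv.Perm S, ∏ e : VPair n, arcProb p (bias q S π e.1.1 e.1.2) (Y e))

/-- The null model with `p = n ^ (-γ)`. -/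
def nullLD (γ : ℝ) (n : ℕ) : Dig n → ℝ := nullProb n ((n : ℝ) ^ (-γ))

/-- The planted model with `q = n ^ (-α)`, `k = n ^ β`, `p = n ^ (-γ)`. -/
def plantedLD (α β γ : ℝ) (n : ℕ) : Dig n → ℝ :=
  plantedProb n ((n : ℝ) ^ β) ((n : ℝ) ^ (-γ)) ((n : ℝ) ^ (-α))

/-! ### Detection, separation, low-degree advantage -/

/-- Strong detection between the null sequence `ν` and the planted sequence `μ`. -/
def StrongDetection (ν μ : ∀ n, Dig n → ℝ) (A : ∀ n, Dig n → Bool) : Prop :=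
  Tendsto (fun n => prob (ν n) (A n) true + prob (μ n) (A n) false) atTop (𝓝 0)

/-- `f` weakly separates `ν` from `μ`: the gap between the means is positive and at least a
constant times the larger standard deviation, for all large `n`. (Without positivity, constant
polynomials would weakly separate any two sequences.) -/
def WeaklySeparates (ν μ : ∀ n, Dig n → ℝ) (f : ∀ n, Poly n) : Prop :=
  ∃ c : ℝ, 0 < c ∧ ∀ᶠ n in atTop,
    0 < expect (μ n) (value (f n)) - expect (ν n) (value (f n)) ∧
    c * max (√(var (ν n) (value (f n)))) (√(var (μ n) (value (f n)))) ≤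
      expect (μ n) (value (f n)) - expect (ν n) (value (f n))

/-- The low-degree advantage of degree `D`. -/
def lowDegAdv {n : ℕ} (D : ℕ) (ν μ : Dig n → ℝ) : ℝ :=
  sSup {r : ℝ | ∃ f : Poly n, f.totalDegree ≤ D ∧ expect ν (fun Y => value f Y ^ 2) ≠ 0 ∧
    r = expect μ (value f) / √(expect ν (fun Y => value f Y ^ 2))}

/-- The polynomial `∑ i, ∑ j < k, Y i j * Y i k`, with `j` and `k` different from `i`. -/
def starPoly (n : ℕ) : Poly n :=
  ∑ i : Fin n, ∑ j : Fin n, ∑ k : Fin n,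
    if j ≠ i ∧ k ≠ i ∧ j < k then MvPolynomial.X (i, j) * MvPolynomial.X (i, k) else 0

/-- The test that outputs `1` if and only if `f(Y) ≥ t`. -/
def thresholdTest (f : ∀ n, Poly n) (t : ℕ → ℝ) (n : ℕ) (Y : Dig n) : Bool :=
  decide (t n ≤ value (f n) Y)

/-! ### Polynomial time: random access machines with unit-cost addition and subtraction -/

/-- Programs of a random access machine whose memory cells, indexed by `ℕ`, hold natural
numbers. -/
inductive Program : Type
  /-- `m[d] := c` -/
  | const (d c : ℕ)
  /-- `m[d] := m[a] + m[b]` -/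
  | add (d a b : ℕ)
  /-- `m[d] := m[a] - m[b]`, or `0` if this is negative -/
  | sub (d a b : ℕ)
  /-- `m[d] := m[m[a]]` -/
  | load (d a : ℕ)
  /-- `m[m[a]] := m[s]` -/
  | store (a s : ℕ)
  /-- `m[d] :=` the input entry in row `m[i]` and column `m[j]` -/
  | read (d i j : ℕ)
  /-- first `P`, then `R` -/
  | seq (P R : Program)
  /-- if `m[a] ≠ 0` then `P`, else `R` -/
  | branch (a : ℕ) (P R : Program)
  /-- while `m[a] ≠ 0` do `P` -/
  | loop (a : ℕ) (P : Program)

/-- `Runs x P m m' t`: on the input matrix `x`, the program `P` started in memory `m` halts in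
memory `m'` after `t` steps; each instruction and each test costs one step. -/
inductive Runs (x : ℕ → ℕ → ℕ) : Program → (ℕ → ℕ) → (ℕ → ℕ) → ℕ → Prop
  | const (d c : ℕ) (m : ℕ → ℕ) : Runs x (.const d c) m (Function.update m d c) 1
  | add (d a b : ℕ) (m : ℕ → ℕ) : Runs x (.add d a b) m (Function.update m d (m a + m b)) 1
  | sub (d a b : ℕ) (m : ℕ → ℕ) : Runs x (.sub d a b) m (Function.update m d (m a - m b)) 1
  | load (d a : ℕ) (m : ℕ → ℕ) : Runs x (.load d a) m (Function.update m d (m (m a))) 1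
  | store (a s : ℕ) (m : ℕ → ℕ) : Runs x (.store a s) m (Function.update m (m a) (m s)) 1
  | read (d i j : ℕ) (m : ℕ → ℕ) :
      Runs x (.read d i j) m (Function.update m d (x (m i) (m j))) 1
  | seq {P R : Program} {m₁ m₂ m₃ : ℕ → ℕ} {s t : ℕ} (hP : Runs x P m₁ m₂ s)
      (hR : Runs x R m₂ m₃ t) : Runs x (.seq P R) m₁ m₃ (s + t)
  | branch_pos {a : ℕ} {P R : Program} {m m' : ℕ → ℕ} {t : ℕ} (ha : m a ≠ 0)
      (hP : Runs x P m m' t) : Runs x (.branch a P R) m m' (t + 1)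
  | branch_zero {a : ℕ} {P R : Program} {m m' : ℕ → ℕ} {t : ℕ} (ha : m a = 0)
      (hR : Runs x R m m' t) : Runs x (.branch a P R) m m' (t + 1)
  | loop_pos {a : ℕ} {P : Program} {m₁ m₂ m₃ : ℕ → ℕ} {s t : ℕ} (ha : m₁ a ≠ 0)
      (hP : Runs x P m₁ m₂ s) (hL : Runs x (.loop a P) m₂ m₃ t) :
      Runs x (.loop a P) m₁ m₃ (s + t + 1)
  | loop_zero {a : ℕ} {P : Program} {m : ℕ → ℕ} (ha : m a = 0) : Runs x (.loop a P) m m 1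

/-- Code of an entry of the adjacency matrix as a natural number. -/
def arcCode : SignType → ℕ
  | SignType.zero => 0
  | SignType.pos => 1
  | SignType.neg => 2

/-- The adjacency matrix as machine input (`0` outside the range of the indices). -/
def inputOf {n : ℕ} (Y : Dig n) (i j : ℕ) : ℕ :=
  if h : i < n ∧ j < n then arcCode (adj Y ⟨i, h.1⟩ ⟨j, h.2⟩) else 0

/-- The sequence of tests `A` is computable in time polynomial in `n`: one program, started with
`n` in cell `0` and `0` in all other cells, halts on every digraph on `[n]` within polynomially
many steps, with the output of `A` in cell `0`. -/
def PolyTime (A : ∀ n, Dig n → Bool) : Prop :=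
  ∃ (P : Program) (T : Polynomial ℕ), ∀ (n : ℕ) (Y : Dig n), ∃ (m : ℕ → ℕ) (t : ℕ),
    Runs (inputOf Y) P (Function.update (fun _ => 0) 0 n) m t ∧ t ≤ T.eval n ∧
      m 0 = (A n Y).toNat

end PRS

end

/-!
Given the community `S` and its ranking, the planted law is a product law on the pairs of vertices
(`tilt`), and the presence of an edge does not depend on `S` or the ranking: only odd powers of the
signed edge variables `Y_e` see the planted structure.

*Below the threshold.* The null law has the orthogonal functions `Y^A = ∏_{e ∈ A} Y_e`, and for
polynomials of degree at most `D` the planted expectation is the null inner product with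
`lowDegRatio`, whose squared norm is `lowDegNormSq = ∑_{|A| ≤ D} (E_P Y^A)² / p^|A|`. By
Cauchy–Schwarz, both claims follow once this norm is `1 + o(1)` (`lowDegAdv_mem_Icc`, `sq_gap_le`).
With `V(A)` the set of vertices touched by `A`, one has `|E_P Y^A| ≤ (2 p q)^|A| (k / n)^|V(A)|`.
Exchanging the ranks of the endpoints of an isolated edge changes the sign of that edge alone, so
`E_P Y^A = 0` if `A` has an isolated edge (`plantedCoeff_eq_zero`). Otherwise
`2 |V(A)| ≤ 3 |A|` (`two_mul_card_verts_le`), and then the condition on `β` makes each term at most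
`(4 n^(-δ))^|A| n^(-|V(A)|)` with `δ > 0`. There are at most `n^v v^(2m)` sets of `m` edges touching
`v` vertices, so the sum over `A ≠ ∅` is at most a power of `D` times `n^(-δ)`, which tends to
zero since `D` is polylogarithmic.

*Above the threshold.* The polynomial sums, over all triples of vertices, the products of the two
edge variables at each of the three vertices. In a ranked triple of the community exactly one
vertex lies between the other two, so the three products of signs are `1, 1, -1`, and the triple
contributes `(2 p q)²` whatever the ranking: given `S` and the ranking, the mean is
`(2 p q)² * (|S| choose 3)` (`starForm_arcMean`). As a quadratic form in independent variables, the
polynomial has conditional variance of order `n p³ q² |S|³ + p² n³`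
(`expect_starForm_biasVec_le`). Chebyshev's inequality, for `|S|` and then conditionally, gives
strong detection with any threshold `n^θ` between the null standard deviation
`n^(3/2) p` and the planted mean `k³ p² q²`, up to constants. For rational `θ = a / b` the test
amounts to comparing `n ^ a` with the `b`-th power of a difference of two counts of at most `n³`
cherries, and a machine does this in polynomially many additions and subtractions.
-/

noncomputable section

namespace PRS

/-! ### Expectations under products and mixtures -/

/-- The product law on digraphs in which the pair `e` has directional bias `b e`. -/
def tilt {n : ℕ} (p : ℝ) (b : VPair n → ℝ) (Y : Dig n) : ℝ := ∏ e, arcProb p (b e) (Y e)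

/-- The signed edge variable `Y_e` as a real number. -/
def arcVal {n : ℕ} (Y : Dig n) (e : VPair n) : ℝ := ((Y e : SignType) : ℝ)

/-- The multilinear monomial `∏_{e ∈ A} Y_e`. -/
def edgeMonomial {n : ℕ} (A : Finset (VPair n)) (Y : Dig n) : ℝ := ∏ e ∈ A, arcVal Y e

/-- The probability of the community `S` in the planted model with inclusion probability `r`. -/
def communityProb (n : ℕ) (r : ℝ) (S : Finset (Fin n)) : ℝ :=
  r ^ S.card * (1 - r) ^ (n - S.card)

lemma nullProb_eq_tilt (n : ℕ) (p : ℝ) : nullProb n p = tilt p (fun _ => 0) := rfl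

lemma sum_signType (g : SignType → ℝ) : ∑ s, g s = g .zero + g .neg + g .pos := by
  have : (Finset.univ : Finset SignType) = {.zero, .neg, .pos} := by decide
  rw [this, Finset.sum_insert (by decide), Finset.sum_insert (by decide), Finset.sum_singleton]
  ring

lemma expect_add {n : ℕ} (μ g h : Dig n → ℝ) :
    expect μ (fun Y => g Y + h Y) = expect μ g + expect μ h := by
  simp [expect, mul_add, Finset.sum_add_distrib]

lemma expect_const_mul {n : ℕ} (μ g : Dig n → ℝ) (c : ℝ) :
    expect μ (fun Y => c * g Y) = c * expect μ g := by
  simp only [expect, Finset.mul_sum]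
  exact Finset.sum_congr rfl fun _ _ => by ring

lemma expect_sum {n : ℕ} {ι : Type*} (μ : Dig n → ℝ) (s : Finset ι) (g : ι → Dig n → ℝ) :
    expect μ (fun Y => ∑ i ∈ s, g i Y) = ∑ i ∈ s, expect μ (g i) := by
  simp only [expect, Finset.mul_sum]
  exact Finset.sum_comm

lemma expect_mono {n : ℕ} {μ g h : Dig n → ℝ} (hμ : ∀ Y, 0 ≤ μ Y) (hgh : ∀ Y, g Y ≤ h Y) :
    expect μ g ≤ expect μ h :=
  Finset.sum_le_sum fun Y _ => mul_le_mul_of_nonneg_left (hgh Y) (hμ Y)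

/-- Cauchy–Schwarz. -/
lemma sq_expect_mul_le {n : ℕ} {μ : Dig n → ℝ} (hμ : ∀ Y, 0 ≤ μ Y) (g h : Dig n → ℝ) :
    expect μ (fun Y => g Y * h Y) ^ 2 ≤
      expect μ (fun Y => g Y ^ 2) * expect μ (fun Y => h Y ^ 2) :=
  Finset.sum_sq_le_sum_mul_sum_of_sq_le_mul _
    (fun Y _ => mul_nonneg (hμ Y) (sq_nonneg _)) (fun Y _ => mul_nonneg (hμ Y) (sq_nonneg _))
    (fun Y _ => le_of_eq (by ring))

lemma expect_tilt_prod {n : ℕ} (p : ℝ) (b : VPair n → ℝ) (h : VPair n → SignType → ℝ) :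
    expect (tilt p b) (fun Y => ∏ e, h e (Y e)) = ∏ e, ∑ s, arcProb p (b e) s * h e s := by
  rw [Fintype.prod_sum]
  simp [expect, tilt, Finset.prod_mul_distrib]

lemma arcProb_nonneg {p b : ℝ} (hp : 0 ≤ p) (hp1 : p ≤ 1) (hb : |b| ≤ 1 / 2) (s : SignType) :
    0 ≤ arcProb p b s := by
  have := abs_le.1 hb
  cases s <;> simp only [arcProb]
  · linarith
  · exact mul_nonneg hp (by linarith)
  · exact mul_nonneg hp (by linarith)

lemma tilt_nonneg {n : ℕ} {p : ℝ} {b : VPair n → ℝ} (hp : 0 ≤ p) (hp1 : p ≤ 1)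
    (hb : ∀ e, |b e| ≤ 1 / 2) (Y : Dig n) : 0 ≤ tilt p b Y :=
  Finset.prod_nonneg fun e _ => arcProb_nonneg hp hp1 (hb e) _

lemma nullProb_nonneg {n : ℕ} {p : ℝ} (hp : 0 ≤ p) (hp1 : p ≤ 1) (Y : Dig n) :
    0 ≤ nullProb n p Y :=
  tilt_nonneg hp hp1 (fun _ => by norm_num) Y

/-- The `a`-th moment of the signed edge variable of a pair with bias `b`. -/
def arcMoment (p b : ℝ) (a : ℕ) : ℝ := if a = 0 then 1 else if Odd a then 2 * p * b else p

lemma sum_arcProb_mul_pow (p b : ℝ) (a : ℕ) :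
    ∑ s : SignType, arcProb p b s * (s : ℝ) ^ a = arcMoment p b a := by
  rw [sum_signType]
  rcases Nat.eq_zero_or_pos a with rfl | ha
  · simp [arcProb, arcMoment]; ring
  · have h0 : a ≠ 0 := ha.ne'
    by_cases ho : Odd a
    · simp [arcProb, arcMoment, h0, ho]; ring
    · have he : Even a := Nat.not_odd_iff_even.1 ho
      simp [arcProb, arcMoment, h0, ho, he]; ring

lemma expect_tilt_prod_pow {n : ℕ} (p : ℝ) (b : VPair n → ℝ) (a : VPair n → ℕ) :
    expect (tilt p b) (fun Y => ∏ e, arcVal Y e ^ a e) = ∏ e, arcMoment p (b e) (a e) := by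
  simp_rw [← sum_arcProb_mul_pow]
  exact expect_tilt_prod p b (fun e s => (s : ℝ) ^ a e)

lemma expect_tilt_one {n : ℕ} (p : ℝ) (b : VPair n → ℝ) :
    expect (tilt p b) (fun _ => 1) = 1 := by
  simpa [arcMoment] using expect_tilt_prod_pow p b (fun _ => 0)

lemma expect_tilt_const {n : ℕ} (p : ℝ) (b : VPair n → ℝ) (c : ℝ) :
    expect (tilt p b) (fun _ => c) = c := by
  simpa [expect_tilt_one] using expect_const_mul (tilt p b) (fun _ => 1) c

/-- The planted law is the mixture of the product laws given the community and its ranking. -/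
lemma expect_plantedProb (n : ℕ) (k p q : ℝ) (g : Dig n → ℝ) :
    expect (plantedProb n k p q) g = ∑ S, communityProb n (k / n) S *
      (((S.card.factorial : ℝ))⁻¹ *
        ∑ π : Equiv.Perm S, expect (tilt p (fun e => bias q S π e.1.1 e.1.2)) g) := by
  simp only [expect, plantedProb, communityProb, Finset.sum_mul, Finset.mul_sum, tilt]
  rw [Finset.sum_comm]
  refine Finset.sum_congr rfl fun S _ => ?_
  rw [Finset.sum_comm]
  exact Finset.sum_congr rfl fun π _ => Finset.sum_congr rfl fun Y _ => by ring

/-- The probability that the random community contains `V`. -/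
lemma sum_communityProb_superset (n : ℕ) (r : ℝ) (V : Finset (Fin n)) :
    ∑ S, (if V ⊆ S then communityProb n r S else 0) = r ^ V.card := by
  have h := Fintype.prod_add (fun _ : Fin n => r) (fun i => if i ∈ V then 0 else 1 - r)
  have h1 : ∏ i : Fin n, (r + if i ∈ V then 0 else 1 - r) = r ^ V.card := by
    have : ∀ i : Fin n, (r + if i ∈ V then 0 else 1 - r) = if i ∈ V then r else 1 := by
      intro i; split_ifs <;> ring
    simp_rw [this]
    rw [Finset.prod_ite_mem, Finset.univ_inter, Finset.prod_const]
  rw [← h1, h]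
  refine Finset.sum_congr rfl fun S _ => ?_
  rw [Finset.prod_const, communityProb]
  split_ifs with hV
  · congr 1
    rw [Finset.prod_congr rfl (g := fun _ => 1 - r), Finset.prod_const, Finset.card_compl,
      Fintype.card_fin]
    intro i hi
    rw [if_neg fun h => Finset.mem_compl.1 hi (hV h)]
  · obtain ⟨i, hiV, hiS⟩ := Finset.not_subset.1 hV
    rw [Finset.prod_eq_zero (Finset.mem_compl.2 hiS) (by simp [hiV]), mul_zero]

lemma sum_communityProb (n : ℕ) (r : ℝ) : ∑ S, communityProb n r S = 1 := by
  simpa using sum_communityProb_superset n r ∅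

lemma communityProb_nonneg {n : ℕ} {r : ℝ} (h0 : 0 ≤ r) (h1 : r ≤ 1) (S : Finset (Fin n)) :
    0 ≤ communityProb n r S :=
  mul_nonneg (pow_nonneg h0 _) (pow_nonneg (by linarith) _)

lemma sum_perm_const (n : ℕ) (S : Finset (Fin n)) (c : ℝ) :
    ((S.card.factorial : ℝ))⁻¹ * ∑ _π : Equiv.Perm S, c = c := by
  rw [Finset.sum_const, Finset.card_univ, Fintype.card_perm, Fintype.card_coe, nsmul_eq_mul,
    ← mul_assoc, inv_mul_cancel₀ (by exact_mod_cast S.card.factorial_ne_zero), one_mul]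

lemma expect_plantedProb_const (n : ℕ) (k p q c : ℝ) :
    expect (plantedProb n k p q) (fun _ => c) = c := by
  rw [expect_plantedProb]
  simp_rw [expect_tilt_const, sum_perm_const, ← Finset.sum_mul, sum_communityProb, one_mul]

/-! ### The low-degree likelihood ratio -/

/-- The set of pairs with an odd exponent. As `Y_e` takes the values `-1, 0, 1`, a monomial depends
on its exponents only through their vanishing and their parity. -/
def oddPart {n : ℕ} (a : VPair n → ℕ) : Finset (VPair n) := Finset.univ.filter fun e => Odd (a e)

/-- The number of pairs with a positive even exponent. -/
def evenCount {n : ℕ} (a : VPair n → ℕ) : ℕ :=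
  (Finset.univ.filter fun e => a e ≠ 0 ∧ ¬ Odd (a e)).card

lemma edgeMonomial_eq_prod_pow {n : ℕ} (A : Finset (VPair n)) (Y : Dig n) :
    edgeMonomial A Y = ∏ e, arcVal Y e ^ (if e ∈ A then 1 else 0) := by
  simp [edgeMonomial, pow_ite, Finset.prod_ite_mem]

lemma expect_tilt_edgeMonomial {n : ℕ} (p : ℝ) (b : VPair n → ℝ) (A : Finset (VPair n)) :
    expect (tilt p b) (edgeMonomial A) = ∏ e ∈ A, 2 * p * b e := by
  have h : edgeMonomial A = fun Y => ∏ e, arcVal Y e ^ (if e ∈ A then 1 else 0) :=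
    funext (edgeMonomial_eq_prod_pow A)
  rw [h, expect_tilt_prod_pow, ← Finset.univ_inter A, ← Finset.prod_ite_mem]
  refine Finset.prod_congr rfl fun e _ => ?_
  simp only [Finset.univ_inter]
  split_ifs <;> simp [arcMoment]

/-- Since the presence of an edge is independent of the ranking, even powers only contribute
factors `p`. -/
lemma prod_arcMoment_eq {n : ℕ} (p : ℝ) (b : VPair n → ℝ) (a : VPair n → ℕ) :
    ∏ e, arcMoment p (b e) (a e) = p ^ evenCount a * ∏ e ∈ oddPart a, 2 * p * b e := by
  have h : ∀ e, arcMoment p (b e) (a e) =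
      (if a e ≠ 0 ∧ ¬ Odd (a e) then p else 1) * (if Odd (a e) then 2 * p * b e else 1) := by
    intro e
    by_cases h0 : a e = 0
    · simp [arcMoment, h0]
    · by_cases ho : Odd (a e)
      · simp [arcMoment, h0, ho]
      · simp [arcMoment, h0, ho]
  rw [Finset.prod_congr rfl fun e _ => h e, Finset.prod_mul_distrib, evenCount, oddPart,
    Finset.prod_filter, ← Finset.prod_const, Finset.prod_filter]

lemma expect_plantedProb_prod_pow {n : ℕ} (k p q : ℝ) (a : VPair n → ℕ) :
    expect (plantedProb n k p q) (fun Y => ∏ e, arcVal Y e ^ a e) =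
      p ^ evenCount a * expect (plantedProb n k p q) (edgeMonomial (oddPart a)) := by
  simp_rw [expect_plantedProb, expect_tilt_prod_pow, prod_arcMoment_eq, expect_tilt_edgeMonomial,
    Finset.mul_sum]
  exact Finset.sum_congr rfl fun S _ => Finset.sum_congr rfl fun π _ => by ring

lemma expect_nullProb_prod_pow_mul {n : ℕ} (p : ℝ) (a : VPair n → ℕ) (A : Finset (VPair n)) :
    expect (nullProb n p) (fun Y => (∏ e, arcVal Y e ^ a e) * edgeMonomial A Y) =
      if A = oddPart a then p ^ (evenCount a + A.card) else 0 := by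
  simp_rw [edgeMonomial_eq_prod_pow, ← Finset.prod_mul_distrib, ← pow_add, nullProb_eq_tilt]
  rw [expect_tilt_prod_pow]
  split_ifs with hA
  · subst hA
    have h : ∀ e, arcMoment p 0 (a e + if e ∈ oddPart a then 1 else 0) =
        (if a e ≠ 0 ∧ ¬ Odd (a e) then p else 1) * (if Odd (a e) then p else 1) := by
      intro e
      by_cases h0 : a e = 0
      · simp [arcMoment, oddPart, h0]
      · by_cases ho : Odd (a e)
        · have : ¬ Odd (a e + 1) := by simpa using ho.add_one
          simp [arcMoment, oddPart, h0, ho, this]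
        · simp [arcMoment, oddPart, h0, ho]
    simp_rw [h, Finset.prod_mul_distrib, pow_add]
    rw [evenCount, ← Finset.prod_const, Finset.prod_filter, ← Finset.prod_const, oddPart,
      Finset.prod_filter]
  · obtain ⟨e, he⟩ : ∃ e, ¬ (e ∈ A ↔ e ∈ oddPart a) := by
      by_contra! h
      exact hA (Finset.ext h)
    refine Finset.prod_eq_zero (Finset.mem_univ e) ?_
    have hodd : Odd (a e + if e ∈ A then 1 else 0) := by
      by_cases heA : e ∈ A
      · have : ¬ Odd (a e) := by simpa [heA, oddPart] using he
        simp only [heA, if_true]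
        exact (Nat.not_odd_iff_even.1 this).add_one
      · simpa [heA, oddPart] using he
    rw [arcMoment, if_neg hodd.pos.ne', if_pos hodd, mul_zero]

/-- The coefficients `E_P Y^A` of the likelihood ratio. -/
def plantedCoeff (n : ℕ) (k p q : ℝ) (A : Finset (VPair n)) : ℝ :=
  expect (plantedProb n k p q) (edgeMonomial A)

/-- The sets of at most `D` pairs. -/
def smallSets (n D : ℕ) : Finset (Finset (VPair n)) := Finset.univ.filter fun A => A.card ≤ D

/-- The projection of the likelihood ratio `dP/dQ` to polynomials of degree at most `D`. Only
multilinear monomials occur, since the presence of edges has the same law under both models. -/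
def lowDegRatio (n : ℕ) (k p q : ℝ) (D : ℕ) (Y : Dig n) : ℝ :=
  ∑ A ∈ smallSets n D, plantedCoeff n k p q A * (p ^ A.card)⁻¹ * edgeMonomial A Y

/-- The squared null norm of `lowDegRatio` (see `expect_lowDegRatio_sq`). -/
def lowDegNormSq (n : ℕ) (k p q : ℝ) (D : ℕ) : ℝ :=
  ∑ A ∈ smallSets n D, plantedCoeff n k p q A ^ 2 * (p ^ A.card)⁻¹

lemma card_oddPart_le {n : ℕ} (a : VPair n → ℕ) : (oddPart a).card ≤ ∑ e, a e := by
  rw [oddPart, Finset.card_filter]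
  refine Finset.sum_le_sum fun e _ => ?_
  split_ifs with h
  · exact h.pos
  · exact Nat.zero_le _

/-- The low-degree likelihood ratio represents the planted expectation of monomials. -/
lemma expect_mul_lowDegRatio_prod_pow {n : ℕ} {k p q : ℝ} (hp : p ≠ 0) {D : ℕ}
    (a : VPair n → ℕ) (ha : ∑ e, a e ≤ D) :
    expect (nullProb n p) (fun Y => (∏ e, arcVal Y e ^ a e) * lowDegRatio n k p q D Y) =
      expect (plantedProb n k p q) (fun Y => ∏ e, arcVal Y e ^ a e) := by
  have h : ∀ Y : Dig n, (∏ e, arcVal Y e ^ a e) * lowDegRatio n k p q D Y =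
      ∑ A ∈ smallSets n D, plantedCoeff n k p q A * (p ^ A.card)⁻¹ *
        ((∏ e, arcVal Y e ^ a e) * edgeMonomial A Y) := by
    intro Y
    rw [lowDegRatio, Finset.mul_sum]
    exact Finset.sum_congr rfl fun A _ => by ring
  simp_rw [h, expect_sum, expect_const_mul, expect_nullProb_prod_pow_mul]
  rw [Finset.sum_eq_single (oddPart a)]
  · rw [if_pos rfl, expect_plantedProb_prod_pow, pow_add, plantedCoeff]
    field_simp
  · intro A _ hA
    rw [if_neg hA, mul_zero]
  · intro hA
    exact absurd (by simpa [smallSets] using (card_oddPart_le a).trans ha) hA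

lemma expect_mul_lowDegRatio_edgeMonomial {n : ℕ} {k p q : ℝ} (hp : p ≠ 0) {D : ℕ}
    (A : Finset (VPair n)) (hA : A.card ≤ D) :
    expect (nullProb n p) (fun Y => edgeMonomial A Y * lowDegRatio n k p q D Y) =
      plantedCoeff n k p q A := by
  have := expect_mul_lowDegRatio_prod_pow (k := k) (q := q) hp (D := D)
    (fun e => if e ∈ A then 1 else 0) (by simpa using hA)
  simp_rw [← edgeMonomial_eq_prod_pow] at this
  exact this

lemma expect_lowDegRatio_sq {n : ℕ} {k p q : ℝ} (hp : p ≠ 0) (D : ℕ) :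
    expect (nullProb n p) (fun Y => lowDegRatio n k p q D Y ^ 2) = lowDegNormSq n k p q D := by
  have h : ∀ Y : Dig n, lowDegRatio n k p q D Y ^ 2 =
      ∑ A ∈ smallSets n D, plantedCoeff n k p q A * (p ^ A.card)⁻¹ *
        (edgeMonomial A Y * lowDegRatio n k p q D Y) := by
    intro Y
    rw [sq]
    nth_rewrite 1 [lowDegRatio]
    rw [Finset.sum_mul]
    exact Finset.sum_congr rfl fun A _ => by ring
  simp_rw [h, expect_sum, expect_const_mul, lowDegNormSq]
  refine Finset.sum_congr rfl fun A hA => ?_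
  rw [expect_mul_lowDegRatio_edgeMonomial hp A (by simpa [smallSets] using hA)]
  ring

lemma adj_eq_arcVal {n : ℕ} (i j : Fin n) :
    ∃ (c : ℝ) (a : VPair n → ℕ), ∑ e, a e ≤ 1 ∧
      ∀ Y : Dig n, ((adj Y i j : SignType) : ℝ) = c * ∏ e, arcVal Y e ^ a e := by
  have key : ∀ (e₀ : VPair n) (Y : Dig n),
      ∏ e, arcVal Y e ^ (if e = e₀ then 1 else 0) = arcVal Y e₀ := fun e₀ Y => by
    simp
  rcases lt_trichotomy i j with h | h | h
  · exact ⟨1, fun e => if e = ⟨(i, j), h⟩ then 1 else 0, by simp, fun Y => by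
      rw [key]; simp [adj, h, arcVal]⟩
  · exact ⟨0, fun _ => 0, by simp, fun Y => by simp [adj, h]⟩
  · exact ⟨-1, fun e => if e = ⟨(j, i), h⟩ then 1 else 0, by simp, fun Y => by
      rw [key]; simp [adj, h, h.not_gt, arcVal]⟩

/-- On digraphs, a monomial in the matrix entries is a multiple of a monomial in the variables
`Y_e` of no larger degree. -/
lemma exists_prod_pow_eq_monomial {n : ℕ} (d : Fin n × Fin n →₀ ℕ) :
    ∃ (c : ℝ) (a : VPair n → ℕ), ∑ e, a e ≤ d.sum (fun _ m => m) ∧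
      ∀ Y : Dig n, (d.prod fun e m => ((adj Y e.1 e.2 : SignType) : ℝ) ^ m) =
        c * ∏ e, arcVal Y e ^ a e := by
  induction d using Finsupp.induction_linear with
  | zero => exact ⟨1, fun _ => 0, by simp, fun Y => by simp⟩
  | add f g hf hg =>
    obtain ⟨c, a, ha, h⟩ := hf
    obtain ⟨c', a', ha', h'⟩ := hg
    refine ⟨c * c', fun e => a e + a' e, ?_, fun Y => ?_⟩
    · rw [Finset.sum_add_distrib, Finsupp.sum_add_index' (by simp) (by simp)]
      exact add_le_add ha ha'
    · rw [Finsupp.prod_add_index' (by simp) (by simp [pow_add]), h, h']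
      simp_rw [pow_add, Finset.prod_mul_distrib]
      ring
  | single x m =>
    obtain ⟨c, a, ha, h⟩ := adj_eq_arcVal x.1 x.2
    refine ⟨c ^ m, fun e => a e * m, ?_, fun Y => ?_⟩
    · rw [← Finset.sum_mul, Finsupp.sum_single_index (by simp)]
      nlinarith
    · rw [Finsupp.prod_single_index (by simp), h, mul_pow, ← Finset.prod_pow]
      simp_rw [pow_mul]

/-- The low-degree likelihood ratio represents the planted expectation of polynomials. -/
lemma expect_value_mul_lowDegRatio {n : ℕ} {k p q : ℝ} (hp : p ≠ 0) {D : ℕ} (f : Poly n)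
    (hf : f.totalDegree ≤ D) :
    expect (nullProb n p) (fun Y => value f Y * lowDegRatio n k p q D Y) =
      expect (plantedProb n k p q) (value f) := by
  have hv : ∀ Y : Dig n, value f Y = ∑ d ∈ f.support, f.coeff d *
      d.prod fun e m => ((adj Y e.1 e.2 : SignType) : ℝ) ^ m := by
    intro Y
    rw [value, MvPolynomial.eval_eq]
    rfl
  have hv' : value f = fun Y : Dig n => ∑ d ∈ f.support, f.coeff d *
      d.prod fun e m => ((adj Y e.1 e.2 : SignType) : ℝ) ^ m := funext hv
  rw [hv']
  simp_rw [Finset.sum_mul, mul_assoc, expect_sum, expect_const_mul]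
  refine Finset.sum_congr rfl fun d hd => ?_
  obtain ⟨c, a, ha, h⟩ := exists_prod_pow_eq_monomial d
  simp_rw [h, mul_assoc, expect_const_mul]
  rw [expect_mul_lowDegRatio_prod_pow hp a
    (ha.trans ((MvPolynomial.le_totalDegree hd).trans hf))]

lemma expect_lowDegRatio {n : ℕ} {k p q : ℝ} (hp : p ≠ 0) (D : ℕ) :
    expect (nullProb n p) (lowDegRatio n k p q D) = 1 := by
  have := expect_value_mul_lowDegRatio (k := k) (q := q) hp (D := D) (1 : Poly n) (by simp)
  have h1 : (value (1 : Poly n)) = fun _ => 1 := by ext Y; simp [value]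
  simpa [h1, expect_plantedProb_const] using this

/-- The advantage of degree `D` is at least that of constants, and at most the norm of the
low-degree likelihood ratio. -/
lemma lowDegAdv_mem_Icc {n : ℕ} {k p q : ℝ} (hp : 0 < p) (hp1 : p ≤ 1) (D : ℕ) :
    lowDegAdv D (nullProb n p) (plantedProb n k p q) ∈
      Set.Icc 1 (√(lowDegNormSq n k p q D)) := by
  have hub : ∀ r ∈ {r : ℝ | ∃ f : Poly n, f.totalDegree ≤ D ∧
      expect (nullProb n p) (fun Y => value f Y ^ 2) ≠ 0 ∧
      r = expect (plantedProb n k p q) (value f) /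
        √(expect (nullProb n p) (fun Y => value f Y ^ 2))}, r ≤ √(lowDegNormSq n k p q D) := by
    rintro r ⟨f, hf, h0, rfl⟩
    have hpos : 0 < expect (nullProb n p) (fun Y => value f Y ^ 2) :=
      lt_of_le_of_ne (Finset.sum_nonneg fun Y _ =>
        mul_nonneg (nullProb_nonneg hp.le hp1 Y) (sq_nonneg _)) h0.symm
    rw [div_le_iff₀ (Real.sqrt_pos.2 hpos), ← expect_value_mul_lowDegRatio hp.ne' f hf,
      ← Real.sqrt_mul' _ hpos.le, ← expect_lowDegRatio_sq hp.ne', mul_comm]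
    exact Real.le_sqrt_of_sq_le (sq_expect_mul_le (nullProb_nonneg hp.le hp1) _ _)
  have hone : (1 : ℝ) ∈ {r : ℝ | ∃ f : Poly n, f.totalDegree ≤ D ∧
      expect (nullProb n p) (fun Y => value f Y ^ 2) ≠ 0 ∧
      r = expect (plantedProb n k p q) (value f) /
        √(expect (nullProb n p) (fun Y => value f Y ^ 2))} := by
    have h1 : (value (1 : Poly n)) = fun _ => 1 := by ext Y; simp [value]
    refine ⟨1, by simp, ?_, ?_⟩ <;>
      simp [h1, expect_plantedProb_const, nullProb_eq_tilt, expect_tilt_const]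
  exact ⟨le_csSup ⟨_, hub⟩ hone, csSup_le ⟨1, hone⟩ hub⟩

/-- The gap of the means of a low-degree polynomial is controlled by its null variance. -/
lemma sq_gap_le {n : ℕ} {k p q : ℝ} (hp : 0 < p) (hp1 : p ≤ 1) {D : ℕ} (f : Poly n)
    (hf : f.totalDegree ≤ D) :
    (expect (plantedProb n k p q) (value f) - expect (nullProb n p) (value f)) ^ 2 ≤
      var (nullProb n p) (value f) * (lowDegNormSq n k p q D - 1) := by
  set m := expect (nullProb n p) (value f) with hm
  have h1 : expect (nullProb n p) (fun Y => (value f Y - m) * (lowDegRatio n k p q D Y - 1)) =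
      expect (plantedProb n k p q) (value f) - m := by
    have h : ∀ Y : Dig n, (value f Y - m) * (lowDegRatio n k p q D Y - 1) =
        value f Y * lowDegRatio n k p q D Y + ((-m) * lowDegRatio n k p q D Y +
          ((-1) * value f Y + m)) := fun Y => by ring
    simp_rw [h]
    rw [expect_add, expect_add, expect_add, expect_const_mul, expect_const_mul,
      expect_value_mul_lowDegRatio hp.ne' f hf, ← hm, expect_lowDegRatio hp.ne',
      nullProb_eq_tilt, expect_tilt_const]
    ring
  have h2 : expect (nullProb n p) (fun Y => (lowDegRatio n k p q D Y - 1) ^ 2) =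
      lowDegNormSq n k p q D - 1 := by
    have h : ∀ Y : Dig n, (lowDegRatio n k p q D Y - 1) ^ 2 =
        lowDegRatio n k p q D Y ^ 2 + ((-2) * lowDegRatio n k p q D Y + 1) := fun Y => by ring
    simp_rw [h]
    rw [expect_add, expect_add, expect_const_mul, expect_lowDegRatio_sq hp.ne',
      expect_lowDegRatio hp.ne', nullProb_eq_tilt, expect_tilt_const]
    ring
  rw [← h1, ← h2]
  exact sq_expect_mul_le (nullProb_nonneg hp.le hp1) _ _

/-! ### Coefficients of the likelihood ratio -/

/-- The set of the two endpoints of a pair. -/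
def ends {n : ℕ} (e : VPair n) : Finset (Fin n) := {e.1.1, e.1.2}

/-- The vertices touched by a set of pairs. -/
def verts {n : ℕ} (A : Finset (VPair n)) : Finset (Fin n) := A.biUnion ends

/-- Every edge of `A` shares a vertex with another edge of `A`. -/
def NoIsolatedEdge {n : ℕ} (A : Finset (VPair n)) : Prop :=
  ∀ e ∈ A, ∃ e' ∈ A, e' ≠ e ∧ ∃ v ∈ ends e, v ∈ ends e'

lemma fst_ne_snd {n : ℕ} (e : VPair n) : e.1.1 ≠ e.1.2 := e.2.ne

lemma abs_bias_le {n : ℕ} {q : ℝ} (hq : 0 ≤ q) (S : Finset (Fin n)) (π : Equiv.Perm S)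
    (i j : Fin n) : |bias q S π i j| ≤ q := by
  unfold bias
  split_ifs <;> simp [abs_of_nonneg hq, hq]

lemma bias_eq_zero {n : ℕ} {q : ℝ} {S : Finset (Fin n)} {π : Equiv.Perm S} {i j : Fin n}
    (h : ¬ (i ∈ S ∧ j ∈ S)) : bias q S π i j = 0 := dif_neg h

lemma plantedCoeff_eq (n : ℕ) (k p q : ℝ) (A : Finset (VPair n)) :
    plantedCoeff n k p q A = ∑ S, communityProb n (k / n) S * (((S.card.factorial : ℝ))⁻¹ *
      ∑ π : Equiv.Perm S, ∏ e ∈ A, 2 * p * bias q S π e.1.1 e.1.2) := by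
  rw [plantedCoeff, expect_plantedProb]
  simp_rw [expect_tilt_edgeMonomial]

lemma abs_prod_bias_le {n : ℕ} {p q : ℝ} (hp : 0 ≤ p) (hq : 0 ≤ q) (A : Finset (VPair n))
    (S : Finset (Fin n)) (π : Equiv.Perm S) :
    |∏ e ∈ A, 2 * p * bias q S π e.1.1 e.1.2| ≤
      if verts A ⊆ S then (2 * p * q) ^ A.card else 0 := by
  split_ifs with h
  · rw [Finset.abs_prod, ← Finset.prod_const]
    refine Finset.prod_le_prod (fun _ _ => abs_nonneg _) fun e _ => ?_
    rw [abs_mul, abs_of_nonneg (by positivity : (0 : ℝ) ≤ 2 * p)]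
    exact mul_le_mul_of_nonneg_left (abs_bias_le hq S π _ _) (by positivity)
  · obtain ⟨v, hv, hvS⟩ := Finset.not_subset.1 h
    obtain ⟨e, he, hve⟩ := Finset.mem_biUnion.1 hv
    rw [Finset.prod_eq_zero he, abs_zero]
    rw [bias_eq_zero, mul_zero]
    rintro ⟨h1, h2⟩
    simp only [ends, Finset.mem_insert, Finset.mem_singleton] at hve
    rcases hve with rfl | rfl <;> contradiction

lemma abs_plantedCoeff_le {n : ℕ} {k p q : ℝ} (hp : 0 ≤ p) (hq : 0 ≤ q) (hr0 : 0 ≤ k / n)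
    (hr1 : k / n ≤ 1) (A : Finset (VPair n)) :
    |plantedCoeff n k p q A| ≤ (2 * p * q) ^ A.card * (k / n) ^ (verts A).card := by
  rw [plantedCoeff_eq, ← sum_communityProb_superset, Finset.mul_sum]
  refine (Finset.abs_sum_le_sum_abs _ _).trans (Finset.sum_le_sum fun S _ => ?_)
  have hw := communityProb_nonneg (n := n) hr0 hr1 S
  have hin : |((S.card.factorial : ℝ))⁻¹ *
      ∑ π : Equiv.Perm S, ∏ e ∈ A, 2 * p * bias q S π e.1.1 e.1.2| ≤
      if verts A ⊆ S then (2 * p * q) ^ A.card else 0 := by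
    rw [← sum_perm_const n S (if verts A ⊆ S then (2 * p * q) ^ A.card else 0), abs_mul,
      abs_of_nonneg (by positivity : (0 : ℝ) ≤ ((S.card.factorial : ℝ))⁻¹)]
    exact mul_le_mul_of_nonneg_left ((Finset.abs_sum_le_sum_abs _ _).trans
      (Finset.sum_le_sum fun π _ => abs_prod_bias_le hp hq A S π)) (by positivity)
  rw [abs_mul, abs_of_nonneg hw]
  refine (mul_le_mul_of_nonneg_left hin hw).trans (le_of_eq ?_)
  split_ifs <;> ring

/-- Exchanging the ranks of the two endpoints of an isolated edge reverses the bias of this edge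
and of no other one, so the coefficient of an edge set with an isolated edge vanishes. -/
lemma plantedCoeff_eq_zero {n : ℕ} (k p q : ℝ) {A : Finset (VPair n)}
    (hA : ¬ NoIsolatedEdge A) : plantedCoeff n k p q A = 0 := by
  simp only [NoIsolatedEdge, not_forall, not_exists, not_and] at hA
  obtain ⟨e₀, he₀, hiso⟩ := hA
  rw [plantedCoeff_eq]
  refine Finset.sum_eq_zero fun S _ => ?_
  by_cases hS : e₀.1.1 ∈ S ∧ e₀.1.2 ∈ S
  swap
  · rw [Finset.sum_eq_zero, mul_zero, mul_zero]
    intro π _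
    exact Finset.prod_eq_zero he₀ (by rw [bias_eq_zero hS, mul_zero])
  set i : S := ⟨e₀.1.1, hS.1⟩ with hi
  set j : S := ⟨e₀.1.2, hS.2⟩ with hj
  have hij : i ≠ j := fun h => fst_ne_snd e₀ (congrArg Subtype.val h)
  have hflip : ∀ π : Equiv.Perm S,
      ∏ e ∈ A, 2 * p * bias q S (π * Equiv.swap i j) e.1.1 e.1.2 =
        -∏ e ∈ A, 2 * p * bias q S π e.1.1 e.1.2 := by
    intro π
    rw [← Finset.mul_prod_erase _ _ he₀, ← Finset.mul_prod_erase _ _ he₀, ← neg_mul]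
    congr 1
    · have h1 : bias q S (π * Equiv.swap i j) e₀.1.1 e₀.1.2 = -bias q S π e₀.1.1 e₀.1.2 := by
        have hne : π i ≠ π j := fun h => hij (π.injective h)
        simp only [bias, dif_pos hS, ← hi, ← hj, Equiv.Perm.mul_apply, Equiv.swap_apply_left,
          Equiv.swap_apply_right]
        rcases lt_or_gt_of_ne hne with h | h
        · simp [h, h.not_gt]
        · simp [h, h.not_gt]
      rw [h1]; ring
    · refine Finset.prod_congr rfl fun e he => ?_
      obtain ⟨hne, heA⟩ := Finset.mem_erase.1 he
      have hout : ∀ (v : Fin n) (hv : v ∈ S), v ∈ ends e →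
          Equiv.swap i j ⟨v, hv⟩ = ⟨v, hv⟩ := by
        intro v hv hve
        refine Equiv.swap_apply_of_ne_of_ne ?_ ?_
        · intro h
          have : v = e₀.1.1 := congrArg Subtype.val h
          exact hiso e heA hne v (by simp [ends, this]) hve
        · intro h
          have : v = e₀.1.2 := congrArg Subtype.val h
          exact hiso e heA hne v (by simp [ends, this]) hve
      congr 1
      unfold bias
      split_ifs with h h1 h2 h2
      · rfl
      · exfalso
        rw [Equiv.Perm.mul_apply, Equiv.Perm.mul_apply, hout _ _ (by simp [ends]),
          hout _ _ (by simp [ends])] at h1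
        exact h2 h1
      · exfalso
        rw [Equiv.Perm.mul_apply, Equiv.Perm.mul_apply, hout _ _ (by simp [ends]),
          hout _ _ (by simp [ends])] at h1
        exact h1 h2
      · rfl
      · rfl
  have hsum : ∑ π : Equiv.Perm S, ∏ e ∈ A, 2 * p * bias q S π e.1.1 e.1.2 =
      -∑ π : Equiv.Perm S, ∏ e ∈ A, 2 * p * bias q S π e.1.1 e.1.2 := by
    rw [← Finset.sum_neg_distrib, ← Equiv.sum_comp (Equiv.mulRight (Equiv.swap i j))]
    exact Finset.sum_congr rfl fun π _ => hflip π
  have hzero : ∑ π : Equiv.Perm S, ∏ e ∈ A, 2 * p * bias q S π e.1.1 e.1.2 = 0 := by linarith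
  rw [hzero, mul_zero, mul_zero]

/-! ### Edge sets without isolated edges -/

/-- Weighting each edge by the reciprocals of the degrees of its endpoints counts the vertices;
without isolated edges each edge has weight at most `1 + 1 / 2`. -/
lemma two_mul_card_verts_le {n : ℕ} {A : Finset (VPair n)} (hA : NoIsolatedEdge A) :
    2 * (verts A).card ≤ 3 * A.card := by
  set d : Fin n → ℕ := fun v => (A.filter fun e => v ∈ ends e).card with hd
  have hpos : ∀ e ∈ A, ∀ v ∈ ends e, 1 ≤ d v := fun e he v hv =>
    Finset.card_pos.2 ⟨e, Finset.mem_filter.2 ⟨he, hv⟩⟩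
  have h1 : ((verts A).card : ℝ) = ∑ e ∈ A, ∑ v ∈ ends e, (1 : ℝ) / d v := by
    have h2 : ∀ v ∈ verts A, ∑ e ∈ A, (if v ∈ ends e then (1 : ℝ) / d v else 0) = 1 := by
      intro v hv
      obtain ⟨e, he, hve⟩ := Finset.mem_biUnion.1 hv
      have := hpos e he v hve
      rw [← Finset.sum_filter, Finset.sum_const, nsmul_eq_mul, mul_one_div]
      exact div_self (by positivity)
    rw [Finset.card_eq_sum_ones, Nat.cast_sum]
    push_cast
    rw [← Finset.sum_congr rfl h2, Finset.sum_comm]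
    refine Finset.sum_congr rfl fun e he => ?_
    rw [← Finset.sum_filter]
    refine Finset.sum_congr ?_ fun _ _ => rfl
    ext v
    simp only [Finset.mem_filter, and_iff_right_iff_imp]
    exact fun hv => Finset.mem_biUnion.2 ⟨e, he, hv⟩
  have h3 : ∀ e ∈ A, ∑ v ∈ ends e, (1 : ℝ) / d v ≤ 3 / 2 := by
    intro e he
    obtain ⟨e', he', hne, v, hv, hv'⟩ := hA e he
    have h2 : 2 ≤ d v := by
      refine Finset.one_lt_card.2 ⟨e, Finset.mem_filter.2 ⟨he, hv⟩, e',
        Finset.mem_filter.2 ⟨he', hv'⟩, hne.symm⟩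
    have hle1 : ∀ w ∈ ends e, (1 : ℝ) / d w ≤ 1 := fun w hw => by
      have : (1 : ℝ) ≤ d w := by exact_mod_cast hpos e he w hw
      exact (div_le_one (by linarith)).2 this
    have hle2 : (1 : ℝ) / d v ≤ 1 / 2 := by
      have : (2 : ℝ) ≤ d v := by exact_mod_cast h2
      exact one_div_le_one_div_of_le (by norm_num) this
    have hsum : ∑ w ∈ ends e, (1 : ℝ) / d w = 1 / d e.1.1 + 1 / d e.1.2 :=
      Finset.sum_pair (fst_ne_snd e)
    rw [hsum]
    have ha := hle1 e.1.1 (by simp [ends])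
    have hb := hle1 e.1.2 (by simp [ends])
    simp only [ends, Finset.mem_insert, Finset.mem_singleton] at hv
    rcases hv with rfl | rfl <;> linarith
  have h4 : ((verts A).card : ℝ) ≤ A.card * (3 / 2) := by
    rw [h1, ← nsmul_eq_mul, ← Finset.sum_const]
    exact Finset.sum_le_sum h3
  have h5 : (2 : ℝ) * (verts A).card ≤ 3 * A.card := by linarith
  exact_mod_cast h5

lemma card_pairs_within_le {n : ℕ} (V : Finset (Fin n)) :
    (Finset.univ.filter fun e : VPair n => ends e ⊆ V).card ≤ V.card ^ 2 := by
  rw [sq, ← Finset.card_product]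
  refine Finset.card_le_card_of_injOn Subtype.val ?_ Subtype.val_injective.injOn
  intro e he
  have he' : ends e ⊆ V := by simpa using he
  exact Finset.mem_coe.2 (Finset.mem_product.2
    ⟨he' (by simp [ends]), he' (by simp [ends])⟩)

/-- A set of `m` edges on a given set of `v ≤ 2 m` vertices is one of at most `(2 m) ^ (2 m)`, and
the weight `n ^ (-v)` compensates the choice of the vertices. -/
lemma sum_inv_pow_card_verts_le (n m : ℕ) :
    ∑ A : Finset (VPair n) with A.card = m ∧ (verts A).card ≤ 2 * m,
      (((n : ℝ) ^ (verts A).card))⁻¹ ≤ (2 * m + 1) * ((2 * m : ℕ) : ℝ) ^ (2 * m) := by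
  classical
  calc ∑ A : Finset (VPair n) with A.card = m ∧ (verts A).card ≤ 2 * m,
        (((n : ℝ) ^ (verts A).card))⁻¹
      = ∑ V : Finset (Fin n) with V.card ≤ 2 * m,
          ∑ A : Finset (VPair n) with (A.card = m ∧ (verts A).card ≤ 2 * m) ∧ verts A = V,
            (((n : ℝ) ^ (verts A).card))⁻¹ := by
        rw [← Finset.sum_fiberwise_of_maps_to (g := verts)
          (t := Finset.univ.filter fun V : Finset (Fin n) => V.card ≤ 2 * m)]
        · exact Finset.sum_congr rfl fun V _ => by rw [Finset.filter_filter]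
        · intro A hA
          simpa using (Finset.mem_filter.1 hA).2.2
    _ ≤ ∑ V : Finset (Fin n) with V.card ≤ 2 * m,
          ((2 * m : ℕ) : ℝ) ^ (2 * m) * (((n : ℝ) ^ V.card))⁻¹ := by
        refine Finset.sum_le_sum fun V hV => ?_
        have hV' : V.card ≤ 2 * m := by simpa using hV
        have hcard : (Finset.univ.filter fun A : Finset (VPair n) =>
            (A.card = m ∧ (verts A).card ≤ 2 * m) ∧ verts A = V).card ≤ (2 * m) ^ (2 * m) := by
          calc _ ≤ (Finset.powersetCard m
                (Finset.univ.filter fun e : VPair n => ends e ⊆ V)).card := by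
                refine Finset.card_le_card fun A hA => ?_
                obtain ⟨⟨h1, -⟩, rfl⟩ := (Finset.mem_filter.1 hA).2
                refine Finset.mem_powersetCard.2 ⟨fun e he => ?_, h1⟩
                exact Finset.mem_filter.2
                  ⟨Finset.mem_univ _, Finset.subset_biUnion_of_mem ends he⟩
            _ ≤ (V.card ^ 2) ^ m := by
                rw [Finset.card_powersetCard]
                exact (Nat.choose_le_pow _ _).trans
                  (Nat.pow_le_pow_left (card_pairs_within_le V) _)
            _ ≤ (2 * m) ^ (2 * m) := by
                rw [← pow_mul]
                exact Nat.pow_le_pow_left hV' _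
        calc _ = ∑ A : Finset (VPair n) with
                (A.card = m ∧ (verts A).card ≤ 2 * m) ∧ verts A = V, (((n : ℝ) ^ V.card))⁻¹ :=
              Finset.sum_congr rfl fun A hA => by rw [(Finset.mem_filter.1 hA).2.2]
          _ ≤ _ := by
              rw [Finset.sum_const, nsmul_eq_mul]
              exact mul_le_mul_of_nonneg_right (by exact_mod_cast hcard) (by positivity)
    _ = ((2 * m : ℕ) : ℝ) ^ (2 * m) *
          ∑ V : Finset (Fin n) with V.card ≤ 2 * m, (((n : ℝ) ^ V.card))⁻¹ := by
        rw [Finset.mul_sum]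
    _ ≤ ((2 * m : ℕ) : ℝ) ^ (2 * m) * (2 * m + 1) := by
        refine mul_le_mul_of_nonneg_left ?_ (by positivity)
        rw [← Finset.sum_fiberwise_of_maps_to (g := Finset.card)
          (t := Finset.range (2 * m + 1)) (fun V hV => by
            simpa [Nat.lt_succ_iff] using hV)]
        calc _ ≤ ∑ _v ∈ Finset.range (2 * m + 1), (1 : ℝ) := by
              refine Finset.sum_le_sum fun v hv => ?_
              rw [Finset.filter_filter]
              calc _ ≤ ∑ V ∈ Finset.powersetCard v (Finset.univ : Finset (Fin n)),
                    (((n : ℝ) ^ V.card))⁻¹ := by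
                    refine Finset.sum_le_sum_of_subset_of_nonneg (fun V hV => ?_)
                      fun _ _ _ => by positivity
                    exact Finset.mem_powersetCard.2
                      ⟨Finset.subset_univ _, (Finset.mem_filter.1 hV).2.2⟩
                _ = n.choose v * ((n : ℝ) ^ v)⁻¹ := by
                    rw [Finset.sum_congr rfl (g := fun _ => ((n : ℝ) ^ v)⁻¹), Finset.sum_const,
                      Finset.card_powersetCard, Finset.card_univ, Fintype.card_fin, nsmul_eq_mul]
                    intro V hV
                    rw [(Finset.mem_powersetCard.1 hV).2]
                _ ≤ (n : ℝ) ^ v * ((n : ℝ) ^ v)⁻¹ := by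
                    refine mul_le_mul_of_nonneg_right ?_ (by positivity)
                    exact_mod_cast Nat.choose_le_pow n v
                _ ≤ 1 := mul_inv_le_one
          _ = 2 * m + 1 := by simp
    _ = _ := by ring

/-- If the coefficient of each edge set without isolated edges is at most
`u ^ |A| n ^ (-|V(A)|)`, the low-degree norm is close to `1`. -/
lemma lowDegNormSq_sub_one_le {n : ℕ} {k p q u : ℝ} {D : ℕ} (hu : 0 ≤ u)
    (hbound : ∀ A : Finset (VPair n), NoIsolatedEdge A →
      plantedCoeff n k p q A ^ 2 * (p ^ A.card)⁻¹ ≤ u ^ A.card * ((n : ℝ) ^ (verts A).card)⁻¹)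
    (hsmall : 12 * (D : ℝ) ^ 3 * u ≤ 1) :
    lowDegNormSq n k p q D - 1 ≤ 12 * (D : ℝ) ^ 4 * u := by
  classical
  have hempty : plantedCoeff n k p q ∅ ^ 2 * (p ^ (∅ : Finset (VPair n)).card)⁻¹ = 1 := by
    have : plantedCoeff n k p q ∅ = 1 := by
      have h : edgeMonomial (∅ : Finset (VPair n)) = fun _ => 1 := by
        ext Y; simp [edgeMonomial]
      rw [plantedCoeff, h, expect_plantedProb_const]
    simp [this]
  have hmem : (∅ : Finset (VPair n)) ∈ smallSets n D := by simp [smallSets]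
  rw [lowDegNormSq, ← Finset.add_sum_erase _ _ hmem, hempty, add_sub_cancel_left]
  have hnn : ∀ A : Finset (VPair n), 0 ≤ u ^ A.card * ((n : ℝ) ^ (verts A).card)⁻¹ :=
    fun A => by positivity
  calc ∑ A ∈ (smallSets n D).erase ∅, plantedCoeff n k p q A ^ 2 * (p ^ A.card)⁻¹
      ≤ ∑ A ∈ (smallSets n D).erase ∅, if (verts A).card ≤ 2 * A.card then
          u ^ A.card * ((n : ℝ) ^ (verts A).card)⁻¹ else 0 := by
        refine Finset.sum_le_sum fun A _ => ?_
        by_cases hA : NoIsolatedEdge A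
        · have := two_mul_card_verts_le hA
          rw [if_pos (by omega)]
          exact hbound A hA
        · rw [plantedCoeff_eq_zero k p q hA]
          split_ifs
          · simpa using hnn A
          · simp
    _ = ∑ m ∈ Finset.Icc 1 D, ∑ A ∈ ((smallSets n D).erase ∅).filter (fun A => A.card = m),
          if (verts A).card ≤ 2 * A.card then
            u ^ A.card * ((n : ℝ) ^ (verts A).card)⁻¹ else 0 := by
        rw [Finset.sum_fiberwise_of_maps_to]
        intro A hA
        obtain ⟨h1, h2⟩ := Finset.mem_erase.1 hA
        rw [Finset.mem_Icc]
        exact ⟨Finset.card_pos.2 (Finset.nonempty_iff_ne_empty.2 h1),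
          by simpa [smallSets] using h2⟩
    _ ≤ ∑ m ∈ Finset.Icc 1 D, 12 * (D : ℝ) ^ 3 * u := by
        refine Finset.sum_le_sum fun m hm => ?_
        obtain ⟨hm1, hmD⟩ := Finset.mem_Icc.1 hm
        calc _ ≤ ∑ A : Finset (VPair n) with A.card = m ∧ (verts A).card ≤ 2 * m,
                u ^ m * (((n : ℝ) ^ (verts A).card))⁻¹ := by
              rw [← Finset.sum_filter, Finset.filter_filter]
              calc _ = ∑ A ∈ ((smallSets n D).erase ∅).filter
                    (fun A => A.card = m ∧ (verts A).card ≤ 2 * A.card),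
                    u ^ m * (((n : ℝ) ^ (verts A).card))⁻¹ :=
                  Finset.sum_congr rfl fun A hA => by rw [(Finset.mem_filter.1 hA).2.1]
                _ ≤ _ := by
                  refine Finset.sum_le_sum_of_subset_of_nonneg (fun A hA => ?_)
                    fun _ _ _ => by positivity
                  obtain ⟨h1, h2⟩ := (Finset.mem_filter.1 hA).2
                  exact Finset.mem_filter.2 ⟨Finset.mem_univ _, h1, h1 ▸ h2⟩
          _ ≤ u ^ m * ((2 * m + 1) * ((2 * m : ℕ) : ℝ) ^ (2 * m)) := by
              rw [← Finset.mul_sum]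
              exact mul_le_mul_of_nonneg_left (sum_inv_pow_card_verts_le n m) (by positivity)
          _ ≤ u ^ m * ((3 * D) ^ m * (4 * (D : ℝ) ^ 2) ^ m) := by
              have hm1' : (1 : ℝ) ≤ m := by exact_mod_cast hm1
              have hmD' : (m : ℝ) ≤ D := by exact_mod_cast hmD
              refine mul_le_mul_of_nonneg_left ?_ (by positivity)
              -- Bounds uniform in `m ≤ D`, so that the sum over `m` costs one more factor `D`.
              refine mul_le_mul ?_ ?_ (by positivity) (by positivity)
              · calc (2 * (m : ℝ) + 1) ≤ 3 * D := by linarith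
                  _ ≤ (3 * D) ^ m := le_self_pow₀ (by linarith) (by omega)
              · rw [pow_mul]
                refine pow_le_pow_left₀ (by positivity) ?_ _
                push_cast
                nlinarith
          _ = (12 * (D : ℝ) ^ 3 * u) ^ m := by
              rw [← mul_pow, ← mul_pow]
              congr 1
              ring
          _ ≤ 12 * (D : ℝ) ^ 3 * u := pow_le_of_le_one (by positivity) hsmall (by omega)
    _ = 12 * (D : ℝ) ^ 4 * u := by
        rw [Finset.sum_const, Nat.card_Icc, nsmul_eq_mul]
        simp only [Nat.add_sub_cancel]
        ring

/-! ### The log-density setting below the threshold -/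

/-- The exponent `δ` such that an edge set `A` without isolated edges contributes at most
`(4 n ^ (-δ)) ^ |A| * n ^ (-|V(A)|)` to the low-degree norm; it is positive exactly when
`γ + 2 α > 0` and `β` is below the detection threshold. -/
def gapExponent (α β γ : ℝ) : ℝ := 2 * α + γ - 3 / 2 * max (2 * β - 1) 0

lemma gapExponent_pos {α β γ : ℝ} (hα : 0 < α) (hγ : 0 < γ)
    (h : β < 2 / 3 * α + 1 / 3 * γ + 1 / 2) : 0 < gapExponent α β γ := by
  unfold gapExponent
  rcases max_cases (2 * β - 1) 0 with h1 | h1 <;> rw [h1.1] <;> linarith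

lemma plantedCoeff_sq_le {α β γ : ℝ} (hβ : β ≤ 1) {n : ℕ} (hn : 1 ≤ n)
    {A : Finset (VPair n)} (hA : NoIsolatedEdge A) :
    plantedCoeff n ((n : ℝ) ^ β) ((n : ℝ) ^ (-γ)) ((n : ℝ) ^ (-α)) A ^ 2 *
        (((n : ℝ) ^ (-γ)) ^ A.card)⁻¹ ≤
      (4 * (n : ℝ) ^ (-gapExponent α β γ)) ^ A.card * ((n : ℝ) ^ (verts A).card)⁻¹ := by
  have hn1 : (1 : ℝ) ≤ n := by exact_mod_cast hn
  have hn0 : (0 : ℝ) < n := by linarith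
  have hr : (n : ℝ) ^ β / n = (n : ℝ) ^ (β - 1) := by
    rw [Real.rpow_sub_one hn0.ne']
  have hr1 : (n : ℝ) ^ β / n ≤ 1 := by
    rw [hr]; exact Real.rpow_le_one_of_one_le_of_nonpos hn1 (by linarith)
  have hle := abs_plantedCoeff_le (n := n) (k := (n : ℝ) ^ β) (p := (n : ℝ) ^ (-γ))
    (q := (n : ℝ) ^ (-α)) (by positivity) (by positivity) (by positivity) hr1 A
  have hsq := pow_le_pow_left₀ (abs_nonneg _) hle 2
  rw [sq_abs] at hsq
  refine (mul_le_mul_of_nonneg_right hsq (by positivity)).trans ?_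
  set m := A.card
  set v := (verts A).card
  have hv : 2 * (v : ℝ) ≤ 3 * m := by exact_mod_cast two_mul_card_verts_le hA
  have e1 : (2 * (n : ℝ) ^ (-γ) * (n : ℝ) ^ (-α)) ^ m =
      2 ^ m * (n : ℝ) ^ ((-γ - α) * m) := by
    rw [mul_assoc, ← Real.rpow_add hn0, mul_pow, ← Real.rpow_natCast ((n : ℝ) ^ _),
      ← Real.rpow_mul hn0.le]
    ring_nf
  have e2 : ((n : ℝ) ^ β / n) ^ v = (n : ℝ) ^ ((β - 1) * v) := by
    rw [hr, ← Real.rpow_natCast, ← Real.rpow_mul hn0.le]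
  have e3 : (((n : ℝ) ^ (-γ)) ^ m)⁻¹ = (n : ℝ) ^ (γ * m) := by
    rw [← Real.rpow_natCast, ← Real.rpow_mul hn0.le, ← Real.rpow_neg hn0.le]
    ring_nf
  have e4 : (4 * (n : ℝ) ^ (-gapExponent α β γ)) ^ m =
      4 ^ m * (n : ℝ) ^ (-gapExponent α β γ * m) := by
    rw [mul_pow, ← Real.rpow_natCast ((n : ℝ) ^ _), ← Real.rpow_mul hn0.le]
  have e5 : ((n : ℝ) ^ v)⁻¹ = (n : ℝ) ^ (-(v : ℝ)) := by
    rw [Real.rpow_neg hn0.le, Real.rpow_natCast]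
  rw [e1, e2, e3, e4, e5]
  have e6 : (2 ^ m * (n : ℝ) ^ ((-γ - α) * m) * (n : ℝ) ^ ((β - 1) * v)) ^ 2 *
      (n : ℝ) ^ (γ * m) =
      4 ^ m * (n : ℝ) ^ (2 * ((-γ - α) * m + (β - 1) * v) + γ * m) := by
    rw [mul_assoc (2 ^ m : ℝ), ← Real.rpow_add hn0, mul_pow, ← pow_mul, mul_comm m 2, pow_mul,
      ← Real.rpow_natCast ((n : ℝ) ^ _), ← Real.rpow_mul hn0.le, mul_assoc,
      ← Real.rpow_add hn0]
    norm_num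
    ring_nf
  rw [e6, mul_assoc, ← Real.rpow_add hn0]
  refine mul_le_mul_of_nonneg_left (Real.rpow_le_rpow_of_exponent_le hn1 ?_) (by positivity)
  have h1 : (2 * β - 1) * v ≤ max (2 * β - 1) 0 * v :=
    mul_le_mul_of_nonneg_right (le_max_left _ _) (by positivity)
  have h2 : max (2 * β - 1) 0 * (2 * v) ≤ max (2 * β - 1) 0 * (3 * m) :=
    mul_le_mul_of_nonneg_left hv (le_max_right _ _)
  unfold gapExponent
  nlinarith

lemma tendsto_pow_mul_rpow_neg {D : ℕ → ℕ} {s δ : ℝ} (hδ : 0 < δ)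
    (hD : (fun n : ℕ => (D n : ℝ)) =O[atTop] fun n : ℕ => Real.log (n : ℝ) ^ s) (j : ℕ)
    (c : ℝ) :
    Tendsto (fun n : ℕ => c * (D n : ℝ) ^ j * (4 * (n : ℝ) ^ (-δ))) atTop (𝓝 0) := by
  -- The `j`-th power of `n ^ (δ / (j + 1))` leaves a factor `n ^ (-δ / (j + 1))`.
  have hlog : (fun n : ℕ => Real.log (n : ℝ) ^ s) =o[atTop]
      fun n : ℕ => (n : ℝ) ^ (δ / (j + 1)) :=
    (isLittleO_log_rpow_rpow_atTop s (by positivity)).comp_tendsto tendsto_natCast_atTop_atTop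
  have h1 : (fun n : ℕ => (D n : ℝ) ^ j) =O[atTop]
      fun n : ℕ => ((n : ℝ) ^ (δ / (j + 1))) ^ j := (hD.trans_isLittleO hlog).isBigO.pow j
  have h2 : (fun n : ℕ => c * (D n : ℝ) ^ j * (4 * (n : ℝ) ^ (-δ))) =O[atTop]
      fun n : ℕ => ((n : ℝ) ^ (δ / (j + 1))) ^ j * (n : ℝ) ^ (-δ) :=
    (h1.const_mul_left c).mul (isBigO_const_mul_self 4 _ _)
  refine h2.trans_tendsto ?_
  have h3 : Tendsto (fun n : ℕ => (n : ℝ) ^ (-(δ / (j + 1)))) atTop (𝓝 0) :=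
    (tendsto_rpow_neg_atTop (by positivity)).comp tendsto_natCast_atTop_atTop
  refine h3.congr' ?_
  filter_upwards [eventually_ge_atTop 1] with n hn
  have hn0 : (0 : ℝ) < n := by exact_mod_cast hn
  rw [← Real.rpow_natCast, ← Real.rpow_mul hn0.le, ← Real.rpow_add hn0]
  congr 1
  field_simp
  ring

/-- Below the threshold, the low-degree norm is `1 + o(1)`. -/
lemma eventually_lowDegNormSq_sub_one_le {α β γ : ℝ} (hα : 0 < α) (hβ : β ≤ 1) (hγ : 0 < γ)
    (h : β < 2 / 3 * α + 1 / 3 * γ + 1 / 2) {D : ℕ → ℕ} {s : ℝ}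
    (hD : (fun n : ℕ => (D n : ℝ)) =O[atTop] fun n : ℕ => Real.log (n : ℝ) ^ s) :
    ∀ η : ℝ, 0 < η → ∀ᶠ n : ℕ in atTop,
      lowDegNormSq n ((n : ℝ) ^ β) ((n : ℝ) ^ (-γ)) ((n : ℝ) ^ (-α)) (D n) - 1 ≤ η := by
  intro η hη
  have hδ := gapExponent_pos hα hγ h
  have h3 := (tendsto_pow_mul_rpow_neg hδ hD 3 12).eventually (eventually_le_nhds one_pos)
  have h4 := (tendsto_pow_mul_rpow_neg hδ hD 4 12).eventually (eventually_le_nhds hη)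
  filter_upwards [h3, h4, eventually_ge_atTop 1] with n hn3 hn4 hn
  have hn0 : (0 : ℝ) < n := by exact_mod_cast hn
  exact (lowDegNormSq_sub_one_le (by positivity)
    (fun A hA => plantedCoeff_sq_le hβ hn hA) hn3).trans hn4

lemma tendsto_lowDegAdv {α β γ : ℝ} (hα : 0 < α) (hβ : β ≤ 1) (hγ : 0 < γ)
    (h : β < 2 / 3 * α + 1 / 3 * γ + 1 / 2) {D : ℕ → ℕ} {s : ℝ}
    (hD : (fun n : ℕ => (D n : ℝ)) =O[atTop] fun n : ℕ => Real.log (n : ℝ) ^ s) :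
    Tendsto (fun n : ℕ => lowDegAdv (D n) (nullLD γ n) (plantedLD α β γ n)) atTop (𝓝 1) := by
  rw [Metric.tendsto_nhds]
  intro η hη
  filter_upwards [eventually_lowDegNormSq_sub_one_le hα hβ hγ h hD η hη,
    eventually_ge_atTop 1] with n hn hn1
  have hn1' : (1 : ℝ) ≤ n := by exact_mod_cast hn1
  obtain ⟨hlo, hhi⟩ := lowDegAdv_mem_Icc (n := n) (k := (n : ℝ) ^ β) (p := (n : ℝ) ^ (-γ))
    (q := (n : ℝ) ^ (-α)) (by positivity)
    (Real.rpow_le_one_of_one_le_of_nonpos hn1' (by linarith)) (D n)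
  have hsq : √(lowDegNormSq n ((n : ℝ) ^ β) ((n : ℝ) ^ (-γ)) ((n : ℝ) ^ (-α)) (D n)) < 1 + η :=
    (Real.sqrt_lt' (by linarith)).2 (by nlinarith)
  rw [Real.dist_eq, abs_lt]
  unfold nullLD plantedLD
  constructor <;> linarith

lemma not_weaklySeparates {α β γ : ℝ} (hα : 0 < α) (hβ : β ≤ 1) (hγ : 0 < γ)
    (h : β < 2 / 3 * α + 1 / 3 * γ + 1 / 2) {D : ℕ → ℕ} {s : ℝ}
    (hD : (fun n : ℕ => (D n : ℝ)) =O[atTop] fun n : ℕ => Real.log (n : ℝ) ^ s)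
    (f : ∀ n, Poly n) (hf : ∀ n, (f n).totalDegree ≤ D n) :
    ¬ WeaklySeparates (nullLD γ) (plantedLD α β γ) f := by
  rintro ⟨c, hc, hev⟩
  obtain ⟨n, ⟨hpos, hsep⟩, hn, hn1⟩ := (hev.and
    ((eventually_lowDegNormSq_sub_one_le hα hβ hγ h hD (c ^ 2 / 2) (by positivity)).and
      (eventually_ge_atTop 1))).exists
  have hn1' : (1 : ℝ) ≤ n := by exact_mod_cast hn1
  have hp : (0 : ℝ) < (n : ℝ) ^ (-γ) := by positivity
  have hp1 : (n : ℝ) ^ (-γ) ≤ 1 := Real.rpow_le_one_of_one_le_of_nonpos hn1' (by linarith)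
  have hgap := sq_gap_le (k := (n : ℝ) ^ β) (q := (n : ℝ) ^ (-α)) hp hp1 (f n) (hf n)
  unfold nullLD plantedLD at hpos hsep
  set V := var (nullProb n ((n : ℝ) ^ (-γ))) (value (f n)) with hV
  have hV0 : 0 ≤ V := Finset.sum_nonneg fun Y _ =>
    mul_nonneg (nullProb_nonneg hp.le hp1 Y) (sq_nonneg _)
  have h1 := (mul_le_mul_of_nonneg_left (le_max_left (√V) _) hc.le).trans hsep
  have h2 := pow_le_pow_left₀ (by positivity) h1 2
  rw [mul_pow, Real.sq_sqrt hV0] at h2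
  have h3 := mul_le_mul_of_nonneg_left hn hV0
  -- Positivity of the gap excludes the case of zero null variance.
  have h4 := pow_pos hpos 2
  nlinarith

/-! ### The cherry polynomial as a quadratic form -/

/-- The skew-symmetric matrix with entries `y e` above the diagonal. -/
def skew {n : ℕ} (y : VPair n → ℝ) (i j : Fin n) : ℝ :=
  if h : i < j then y ⟨(i, j), h⟩ else if h : j < i then -y ⟨(j, i), h⟩ else 0

/-- The signed incidence of the vertex `i` with the pair `e`. -/
def inc {n : ℕ} (i : Fin n) (e : VPair n) : ℝ :=
  (if e.1.1 = i then 1 else 0) - (if e.1.2 = i then 1 else 0)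

/-- Half the sum over `i` of the squared row sum minus the sum of the squares in the row. -/
def starForm {n : ℕ} (y : VPair n → ℝ) : ℝ :=
  (∑ i, (∑ j, skew y i j) ^ 2 - ∑ i, ∑ j, skew y i j ^ 2) / 2

/-- The symmetric matrix with zero diagonal of the quadratic form `2 * starForm`. -/
def starCoeff {n : ℕ} (e e' : VPair n) : ℝ := if e = e' then 0 else ∑ i, inc i e * inc i e'

lemma skew_self {n : ℕ} (y : VPair n → ℝ) (i : Fin n) : skew y i i = 0 := by simp [skew]

lemma adj_eq_skew {n : ℕ} (Y : Dig n) (i j : Fin n) :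
    ((adj Y i j : SignType) : ℝ) = skew (arcVal Y) i j := by
  unfold adj skew arcVal
  split_ifs <;> simp

lemma sum_vpair {n : ℕ} (F : Fin n → Fin n → ℝ) :
    ∑ e : VPair n, F e.1.1 e.1.2 = ∑ a, ∑ b, if a < b then F a b else 0 := by
  rw [← Finset.sum_subtype (Finset.univ.filter fun e : Fin n × Fin n => e.1 < e.2) (by simp)
    (fun e => F e.1 e.2), Finset.sum_filter, Fintype.sum_prod_type]

lemma sum_row {n : ℕ} (G : Fin n → Fin n → ℝ) (i : Fin n) (h0 : G i i = 0) :
    ∑ j, G i j = ∑ e : VPair n, ((if e.1.1 = i then G e.1.1 e.1.2 else 0) +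
      (if e.1.2 = i then G e.1.2 e.1.1 else 0)) := by
  rw [sum_vpair (fun a b => (if a = i then G a b else 0) + (if b = i then G b a else 0))]
  have h1 : ∀ a b : Fin n, (if a < b then
      ((if a = i then G a b else 0) + (if b = i then G b a else 0)) else 0) =
      (if a = i then (if i < b then G i b else 0) else 0) +
      (if b = i then (if a < i then G i a else 0) else 0) := by
    intro a b
    by_cases ha : a = i <;> by_cases hb : b = i
    · subst ha; subst hb; simp
    · subst ha; simp [hb]
    · subst hb; simp [ha]
    · simp [ha, hb]
  simp_rw [h1, Finset.sum_add_distrib]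
  rw [Finset.sum_comm]
  simp only [Finset.sum_ite_eq', Finset.mem_univ, if_true]
  rw [← Finset.sum_add_distrib]
  refine Finset.sum_congr rfl fun j _ => ?_
  rcases lt_trichotomy i j with h | h | h
  · simp [h, h.not_gt]
  · subst h; simp [h0]
  · simp [h, h.not_gt]

lemma sum_skew {n : ℕ} (y : VPair n → ℝ) (i : Fin n) :
    ∑ j, skew y i j = ∑ e, inc i e * y e := by
  rw [sum_row (skew y) i (skew_self y i)]
  refine Finset.sum_congr rfl fun e _ => ?_
  have := fst_ne_snd e
  have hlt := e.2
  rw [show skew y e.1.1 e.1.2 = y e by simp [skew, hlt],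
    show skew y e.1.2 e.1.1 = -y e by simp [skew, hlt, hlt.not_gt]]
  unfold inc
  split_ifs <;> ring

lemma sum_skew_sq {n : ℕ} (y : VPair n → ℝ) (i : Fin n) :
    ∑ j, skew y i j ^ 2 = ∑ e, inc i e ^ 2 * y e ^ 2 := by
  rw [sum_row (fun i j => skew y i j ^ 2) i (by simp [skew_self])]
  refine Finset.sum_congr rfl fun e _ => ?_
  have hne := fst_ne_snd e
  have hlt := e.2
  rw [show skew y e.1.1 e.1.2 = y e by simp [skew, hlt],
    show skew y e.1.2 e.1.1 = -y e by simp [skew, hlt, hlt.not_gt]]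
  unfold inc
  split_ifs with h1 h2 h2
  · exact absurd (h1.trans h2.symm) hne
  all_goals ring

lemma sum_inc_mul {n : ℕ} (e : VPair n) (x : Fin n → ℝ) :
    ∑ i, inc i e * x i = x e.1.1 - x e.1.2 := by
  simp [inc, sub_mul, Finset.sum_sub_distrib]

lemma sum_inc_sq_mul {n : ℕ} (e : VPair n) (x : Fin n → ℝ) :
    ∑ i, inc i e ^ 2 * x i = x e.1.1 + x e.1.2 := by
  have : ∀ i, inc i e ^ 2 = (if e.1.1 = i then 1 else 0) + (if e.1.2 = i then 1 else 0) := by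
    intro i
    have hne := fst_ne_snd e
    unfold inc
    split_ifs with h1 h2 h2
    · exact absurd (h1.trans h2.symm) hne
    all_goals ring
  simp [this, add_mul, Finset.sum_add_distrib]

lemma sum_inc_sq {n : ℕ} (e : VPair n) : ∑ i, inc i e ^ 2 = 2 := by
  have := sum_inc_sq_mul e (fun _ => 1)
  norm_num at this
  exact this

lemma sum_edges_inc_sq_le {n : ℕ} (i : Fin n) : ∑ e : VPair n, inc i e ^ 2 ≤ n := by
  have h := sum_skew_sq (fun _ : VPair n => (1 : ℝ)) i
  simp only [one_pow, mul_one] at h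
  rw [← h]
  calc _ ≤ ∑ _j : Fin n, (1 : ℝ) := Finset.sum_le_sum fun j _ => by
        unfold skew; split_ifs <;> norm_num
    _ = n := by simp

lemma starCoeff_comm {n : ℕ} (e e' : VPair n) : starCoeff e e' = starCoeff e' e := by
  simp [starCoeff, eq_comm, mul_comm]

lemma starCoeff_self {n : ℕ} (e : VPair n) : starCoeff e e = 0 := by simp [starCoeff]

lemma sum_starCoeff_mul {n : ℕ} (y : VPair n → ℝ) (e : VPair n) :
    ∑ e', starCoeff e e' * y e' = ∑ j, skew y e.1.1 j - ∑ j, skew y e.1.2 j - 2 * y e := by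
  have h : ∀ e', starCoeff e e' * y e' =
      (∑ i, inc i e * (inc i e' * y e')) - if e = e' then 2 * y e else 0 := by
    intro e'
    unfold starCoeff
    split_ifs with h
    · subst h
      simp_rw [← mul_assoc, ← sq, ← Finset.sum_mul, sum_inc_sq]
      ring
    · simp_rw [← mul_assoc, ← Finset.sum_mul]
      ring
  simp_rw [h, Finset.sum_sub_distrib]
  rw [Finset.sum_comm]
  simp_rw [← Finset.mul_sum, ← sum_skew, sum_inc_mul]
  simp

lemma two_mul_starForm {n : ℕ} (y : VPair n → ℝ) :
    2 * starForm y = ∑ e, ∑ e', starCoeff e e' * y e * y e' := by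
  have h1 : ∀ e, ∑ e', starCoeff e e' * y e * y e' =
      (∑ i, inc i e * ∑ j, skew y i j) * y e - 2 * y e ^ 2 := by
    intro e
    have : ∀ e', starCoeff e e' * y e * y e' = y e * (starCoeff e e' * y e') := fun _ => by ring
    simp_rw [this, ← Finset.mul_sum, sum_starCoeff_mul, sum_inc_mul]
    ring
  simp_rw [h1, Finset.sum_sub_distrib, Finset.sum_mul]
  rw [Finset.sum_comm]
  have h2 : ∀ i, ∑ e, inc i e * (∑ j, skew y i j) * y e = (∑ j, skew y i j) ^ 2 := by
    intro i
    calc _ = (∑ j, skew y i j) * ∑ e, inc i e * y e := by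
          rw [Finset.mul_sum]
          exact Finset.sum_congr rfl fun _ _ => by ring
      _ = _ := by rw [← sum_skew, sq]
  have h3 : ∑ i : Fin n, ∑ j, skew y i j ^ 2 = ∑ e, 2 * y e ^ 2 := by
    simp_rw [sum_skew_sq]
    rw [Finset.sum_comm]
    exact Finset.sum_congr rfl fun e _ => by rw [← Finset.sum_mul, sum_inc_sq]
  simp_rw [h2, ← h3]
  unfold starForm
  ring

lemma sum_pairs_lt {n : ℕ} (a : Fin n → ℝ) (i : Fin n) (h0 : a i = 0) :
    ∑ j, ∑ k, (if j ≠ i ∧ k ≠ i ∧ j < k then a j * a k else 0) =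
      ((∑ j, a j) ^ 2 - ∑ j, a j ^ 2) / 2 := by
  have h1 : ∀ j k, (if j ≠ i ∧ k ≠ i ∧ j < k then a j * a k else 0) =
      if j < k then a j * a k else 0 := by
    intro j k
    by_cases hj : j = i
    · subst hj; simp [h0]
    · by_cases hk : k = i
      · subst hk; simp [h0]
      · simp [hj, hk]
  simp_rw [h1]
  have h2 : (∑ j, a j) ^ 2 = ∑ j, ∑ k, ((if j < k then a j * a k else 0) +
      (if k < j then a k * a j else 0) + if j = k then a j ^ 2 else 0) := by
    rw [sq, Finset.sum_mul_sum]
    refine Finset.sum_congr rfl fun j _ => Finset.sum_congr rfl fun k _ => ?_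
    rcases lt_trichotomy j k with h | h | h
    · simp [h, h.not_gt, h.ne]
    · subst h; simp [sq]
    · simp [h, h.not_gt, h.ne', mul_comm]
  have h3 : ∑ j, ∑ k, (if k < j then a k * a j else 0) =
      ∑ j, ∑ k, (if j < k then a j * a k else 0) := Finset.sum_comm
  rw [h2]
  simp_rw [Finset.sum_add_distrib]
  rw [h3]
  simp only [Finset.sum_ite_eq, Finset.mem_univ, if_true]
  ring

lemma value_starPoly {n : ℕ} (Y : Dig n) : value (starPoly n) Y = starForm (arcVal Y) := by
  have h : value (starPoly n) Y = ∑ i, ∑ j, ∑ k, (if j ≠ i ∧ k ≠ i ∧ j < k then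
      skew (arcVal Y) i j * skew (arcVal Y) i k else 0) := by
    simp only [value, starPoly, map_sum]
    refine Finset.sum_congr rfl fun i _ => Finset.sum_congr rfl fun j _ =>
      Finset.sum_congr rfl fun k _ => ?_
    split_ifs
    · simp [adj_eq_skew]
    · simp
  rw [h]
  simp_rw [sum_pairs_lt (skew (arcVal Y) _) _ (skew_self _ _)]
  rw [starForm, ← Finset.sum_sub_distrib, Finset.sum_div]

lemma totalDegree_starPoly_le (n : ℕ) : (starPoly n).totalDegree ≤ 2 := by
  unfold starPoly
  refine MvPolynomial.totalDegree_finsetSum_le fun i _ =>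
    MvPolynomial.totalDegree_finsetSum_le fun j _ =>
    MvPolynomial.totalDegree_finsetSum_le fun k _ => ?_
  split_ifs
  · exact (MvPolynomial.totalDegree_mul _ _).trans (by simp)
  · simp

lemma sum_starCoeff_sq_le (n : ℕ) :
    ∑ e : VPair n, ∑ e' : VPair n, starCoeff e e' ^ 2 ≤ 2 * (n : ℝ) ^ 3 := by
  have h1 : ∀ e e' : VPair n, starCoeff e e' ^ 2 ≤ 2 * ∑ i, inc i e ^ 2 * inc i e' ^ 2 := by
    intro e e'
    unfold starCoeff
    split_ifs
    · rw [sq, mul_zero]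
      exact mul_nonneg (by norm_num) (Finset.sum_nonneg fun i _ => by positivity)
    · -- Cauchy–Schwarz for `inc i e` and `inc i e * inc i e'`, as `inc i e` is `0`, `1` or `-1`.
      rw [← sum_inc_sq e]
      refine Finset.sum_sq_le_sum_mul_sum_of_sq_le_mul _ (fun _ _ => sq_nonneg _)
        (fun _ _ => by positivity) fun i _ => ?_
      have : inc i e = 0 ∨ inc i e ^ 2 = 1 := by
        unfold inc; split_ifs <;> norm_num
      rcases this with h | h
      · simp [h]
      · rw [mul_pow, h]; ring_nf; rfl
  calc _ ≤ ∑ e : VPair n, ∑ e' : VPair n, 2 * ∑ i, inc i e ^ 2 * inc i e' ^ 2 :=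
        Finset.sum_le_sum fun e _ => Finset.sum_le_sum fun e' _ => h1 e e'
    _ = 2 * ∑ i, (∑ e : VPair n, inc i e ^ 2) ^ 2 := by
        simp_rw [← Finset.mul_sum, sq (∑ e, _), Finset.sum_mul_sum]
        congr 1
        rw [Finset.sum_comm]
        conv_rhs => rw [Finset.sum_comm]
        rw [Finset.sum_comm]
        exact Finset.sum_congr rfl fun e _ => Finset.sum_comm
    _ ≤ 2 * ∑ _i : Fin n, (n : ℝ) ^ 2 := by
        refine mul_le_mul_of_nonneg_left (Finset.sum_le_sum fun i _ => ?_) (by norm_num)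
        exact pow_le_pow_left₀ (Finset.sum_nonneg fun _ _ => sq_nonneg _)
          (sum_edges_inc_sq_le i) 2
    _ = _ := by simp; ring

lemma sum_starCoeff_mul_sq_le {n : ℕ} (y : VPair n → ℝ) :
    ∑ e, (∑ e', starCoeff e e' * y e') ^ 2 ≤
      3 * n * ∑ i, (∑ j, skew y i j) ^ 2 + 6 * ∑ i, ∑ j, skew y i j ^ 2 := by
  set x : Fin n → ℝ := fun i => ∑ j, skew y i j with hx
  have h3 : ∑ i : Fin n, ∑ j, skew y i j ^ 2 = ∑ e, 2 * y e ^ 2 := by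
    simp_rw [sum_skew_sq]
    rw [Finset.sum_comm]
    exact Finset.sum_congr rfl fun e _ => by rw [← Finset.sum_mul, sum_inc_sq]
  calc _ ≤ ∑ e : VPair n, (3 * (∑ i, inc i e ^ 2 * x i ^ 2) + 6 * (2 * y e ^ 2)) := by
        refine Finset.sum_le_sum fun e _ => ?_
        rw [sum_starCoeff_mul, sum_inc_sq_mul]
        change (x e.1.1 - x e.1.2 - 2 * y e) ^ 2 ≤ _
        nlinarith [sq_nonneg (x e.1.1 + x e.1.2), sq_nonneg (x e.1.1 + 2 * y e),
          sq_nonneg (x e.1.2 - 2 * y e)]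
    _ = 3 * ∑ i, (∑ e : VPair n, inc i e ^ 2) * x i ^ 2 + 6 * ∑ e, 2 * y e ^ 2 := by
        rw [Finset.sum_add_distrib, ← Finset.mul_sum, ← Finset.mul_sum, Finset.sum_comm]
        simp_rw [Finset.sum_mul]
    _ ≤ 3 * ∑ i, (n : ℝ) * x i ^ 2 + 6 * ∑ e, 2 * y e ^ 2 := by
        gcongr with i _
        exact sum_edges_inc_sq_le i
    _ = _ := by rw [h3, ← Finset.mul_sum]; ring

/-! ### Second moments of quadratic forms in independent variables -/

/-- The mean of the signed edge variable. -/
def arcMean {n : ℕ} (p : ℝ) (b : VPair n → ℝ) (e : VPair n) : ℝ := 2 * p * b e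

/-- The centered signed edge variable. -/
def centered {n : ℕ} (p : ℝ) (b : VPair n → ℝ) (Y : Dig n) (e : VPair n) : ℝ :=
  arcVal Y e - arcMean p b e

/-- The variance of the signed edge variable. -/
def arcVar {n : ℕ} (p : ℝ) (b : VPair n → ℝ) (e : VPair n) : ℝ := p - arcMean p b e ^ 2

/-- The central moments of order at most two. -/
def centralMoment {n : ℕ} (p : ℝ) (b : VPair n → ℝ) (e : VPair n) (k : ℕ) : ℝ :=
  ∑ s : SignType, arcProb p (b e) s * ((s : ℝ) - arcMean p b e) ^ k

lemma centralMoment_zero {n : ℕ} (p : ℝ) (b : VPair n → ℝ) (e : VPair n) :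
    centralMoment p b e 0 = 1 := by
  rw [centralMoment, sum_signType]; simp [arcProb]; ring

lemma centralMoment_one {n : ℕ} (p : ℝ) (b : VPair n → ℝ) (e : VPair n) :
    centralMoment p b e 1 = 0 := by
  rw [centralMoment, sum_signType]; simp [arcProb, arcMean]; ring

lemma centralMoment_two {n : ℕ} (p : ℝ) (b : VPair n → ℝ) (e : VPair n) :
    centralMoment p b e 2 = arcVar p b e := by
  rw [centralMoment, sum_signType]; simp [arcProb, arcVar, arcMean]; ring

lemma expect_prod_centered_pow {n : ℕ} (p : ℝ) (b : VPair n → ℝ) (k : VPair n → ℕ) :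
    expect (tilt p b) (fun Y => ∏ e, centered p b Y e ^ k e) = ∏ e, centralMoment p b e (k e) :=
  expect_tilt_prod p b (fun e s => ((s : ℝ) - arcMean p b e) ^ k e)

lemma expect_centered_mul {n : ℕ} (p : ℝ) (b : VPair n → ℝ) (a c : VPair n) :
    expect (tilt p b) (fun Y => centered p b Y a * centered p b Y c) =
      if a = c then arcVar p b a else 0 := by
  have h := expect_prod_centered_pow p b
    (fun e => (if e = a then 1 else 0) + (if e = c then 1 else 0))
  simp only [pow_add, Finset.prod_mul_distrib, pow_ite, pow_one, pow_zero, Finset.prod_ite_eq',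
    Finset.mem_univ, if_true] at h
  rw [h]
  split_ifs with hac
  · subst hac
    rw [Finset.prod_eq_single a]
    · simp [← centralMoment_two]
    · intro e _ he; simp [he, centralMoment_zero]
    · simp
  · exact Finset.prod_eq_zero (Finset.mem_univ a) (by simp [hac, centralMoment_one])

/-- Fourth-order moments of centered variables over two pairs of distinct indices vanish unless
the two pairs agree up to order. -/
lemma expect_centered_mul_four {n : ℕ} (p : ℝ) (b : VPair n → ℝ) {a c a' c' : VPair n}
    (hac : a ≠ c) (hac' : a' ≠ c') :
    expect (tilt p b) (fun Y => centered p b Y a * centered p b Y c *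
        (centered p b Y a' * centered p b Y c')) =
      (if a' = a then if c' = c then arcVar p b a * arcVar p b c else 0 else 0) +
      (if a' = c then if c' = a then arcVar p b a * arcVar p b c else 0 else 0) := by
  have h := expect_prod_centered_pow p b
    (fun e => ((if e = a then 1 else 0) + (if e = c then 1 else 0)) +
      ((if e = a' then 1 else 0) + (if e = c' then 1 else 0)))
  simp only [pow_add, Finset.prod_mul_distrib, pow_ite, pow_one, pow_zero, Finset.prod_ite_eq',
    Finset.mem_univ, if_true] at h
  rw [h]
  have htwo : ∏ e, centralMoment p b e (((if e = a then 1 else 0) + (if e = c then 1 else 0)) +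
      ((if e = a then 1 else 0) + (if e = c then 1 else 0))) =
      arcVar p b a * arcVar p b c := by
    rw [Finset.prod_eq_mul a c hac]
    · simp [hac, hac.symm, ← centralMoment_two]
    · intro e _ he; simp [he.1, he.2, centralMoment_zero]
    · simp
    · simp
  by_cases h1 : a' = a
  · subst h1
    by_cases h2 : c' = c
    · subst h2
      rw [htwo]; simp [hac]
    · rw [Finset.prod_eq_zero (Finset.mem_univ c)]
      · simp [h2, hac]
      · simp [hac.symm, Ne.symm h2, centralMoment_one]
  · by_cases h2 : a' = c
    · subst h2
      by_cases h3 : c' = a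
      · subst h3
        simp_rw [add_comm (if _ = a' then 1 else 0)] at htwo ⊢
        rw [htwo]; simp [h1]
      · rw [Finset.prod_eq_zero (Finset.mem_univ a)]
        · simp [h1, h3]
        · simp [Ne.symm h1, Ne.symm h3, centralMoment_one]
    · rw [Finset.prod_eq_zero (Finset.mem_univ a')]
      · simp [h1, h2]
      · simp [h1, h2, hac', centralMoment_one]

lemma expect_linear_sq {n : ℕ} (p : ℝ) (b w : VPair n → ℝ) :
    expect (tilt p b) (fun Y => (∑ a, w a * centered p b Y a) ^ 2) =
      ∑ a, w a ^ 2 * arcVar p b a := by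
  have h : ∀ Y : Dig n, (∑ a, w a * centered p b Y a) ^ 2 =
      ∑ a, ∑ c, w a * w c * (centered p b Y a * centered p b Y c) := by
    intro Y
    rw [sq, Finset.sum_mul_sum]
    exact Finset.sum_congr rfl fun _ _ => Finset.sum_congr rfl fun _ _ => by ring
  simp_rw [h, expect_sum, expect_const_mul, expect_centered_mul]
  refine Finset.sum_congr rfl fun a _ => ?_
  simp [sq]

lemma expect_quadratic_sq {n : ℕ} (p : ℝ) (b : VPair n → ℝ) (B : VPair n → VPair n → ℝ)
    (hsymm : ∀ a c, B a c = B c a) (hdiag : ∀ a, B a a = 0) :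
    expect (tilt p b) (fun Y => (∑ a, ∑ c, B a c * (centered p b Y a * centered p b Y c)) ^ 2) =
      2 * ∑ a, ∑ c, B a c ^ 2 * (arcVar p b a * arcVar p b c) := by
  have h : ∀ Y : Dig n, (∑ a, ∑ c, B a c * (centered p b Y a * centered p b Y c)) ^ 2 =
      ∑ a, ∑ c, ∑ a', ∑ c', B a c * B a' c' * (centered p b Y a * centered p b Y c *
        (centered p b Y a' * centered p b Y c')) := by
    intro Y
    rw [sq]
    simp_rw [Finset.sum_mul, Finset.mul_sum]
    exact Finset.sum_congr rfl fun _ _ => Finset.sum_congr rfl fun _ _ =>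
      Finset.sum_congr rfl fun _ _ => Finset.sum_congr rfl fun _ _ => by ring
  have h4 : ∀ a c a' c', B a c * B a' c' * expect (tilt p b) (fun Y => centered p b Y a *
      centered p b Y c * (centered p b Y a' * centered p b Y c')) =
      (if a' = a then if c' = c then B a c * B a c * (arcVar p b a * arcVar p b c) else 0
        else 0) +
      (if a' = c then if c' = a then B a c * B c a * (arcVar p b a * arcVar p b c) else 0
        else 0) := by
    intro a c a' c'
    by_cases hac : a = c
    · subst hac; simp [hdiag]
    · by_cases hac' : a' = c'
      · subst hac'
        rw [hdiag, mul_zero, zero_mul]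
        by_cases h1 : a' = a
        · subst h1; simp [hac]
        · simp [h1]
      · rw [expect_centered_mul_four p b hac hac', mul_add]
        congr 1
        · split_ifs with h1 h2
          · rw [h1, h2]
          · rw [mul_zero]
          · rw [mul_zero]
        · split_ifs with h1 h2
          · rw [h1, h2]
          · rw [mul_zero]
          · rw [mul_zero]
  have h5 : ∀ (a c : VPair n) (x : ℝ),
      ∑ a', ∑ c', (if a' = a then if c' = c then x else 0 else 0) = x := by
    intro a c x
    rw [Finset.sum_eq_single a (fun a' _ h => by simp [h]) (by simp)]
    simp
  simp_rw [h, expect_sum, expect_const_mul, h4, Finset.sum_add_distrib, h5, Finset.mul_sum]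
  rw [← Finset.sum_add_distrib]
  refine Finset.sum_congr rfl fun a _ => ?_
  rw [← Finset.sum_add_distrib]
  refine Finset.sum_congr rfl fun c _ => ?_
  rw [hsymm c a]
  ring

/-- Concentration of the cherry polynomial under a product law: the linear part of its expansion
around the mean gives the terms in `arcMean`, the quadratic part the term `2 * p ^ 2 * n ^ 3`. -/
lemma expect_starForm_sub_sq_le {n : ℕ} {p : ℝ} {b : VPair n → ℝ} (hp : 0 ≤ p) (hp1 : p ≤ 1)
    (hb : ∀ e, |b e| ≤ 1 / 2) :
    expect (tilt p b) (fun Y => (starForm (arcVal Y) - starForm (arcMean p b)) ^ 2) ≤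
      2 * p * (3 * n * ∑ i, (∑ j, skew (arcMean p b) i j) ^ 2 +
        6 * ∑ i, ∑ j, skew (arcMean p b) i j ^ 2) + 2 * p ^ 2 * (n : ℝ) ^ 3 := by
  set μ := arcMean p b with hμ
  set w : VPair n → ℝ := fun e => ∑ e', starCoeff e e' * μ e' with hw
  have hv0 : ∀ e, 0 ≤ arcVar p b e := fun e => by
    rw [← centralMoment_two]
    exact Finset.sum_nonneg fun s _ =>
      mul_nonneg (arcProb_nonneg hp hp1 (hb e) s) (sq_nonneg _)
  have hvp : ∀ e, arcVar p b e ≤ p := fun e => by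
    unfold arcVar; nlinarith [sq_nonneg (arcMean p b e)]
  -- Expansion around the mean into a linear and a quadratic form in the centered variables.
  have hexp : ∀ Y : Dig n, starForm (arcVal Y) - starForm μ =
      ∑ a, w a * centered p b Y a +
        2⁻¹ * ∑ a, ∑ c, starCoeff a c * (centered p b Y a * centered p b Y c) := by
    intro Y
    have h1 : ∀ a c, starCoeff a c * arcVal Y a * arcVal Y c =
        starCoeff a c * (centered p b Y a * centered p b Y c) +
        starCoeff a c * μ c * centered p b Y a +
        starCoeff c a * μ a * centered p b Y c + starCoeff a c * μ a * μ c := by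
      intro a c
      rw [starCoeff_comm c a, centered, centered, ← hμ]
      ring
    have h2 := two_mul_starForm (arcVal Y)
    have h3 := two_mul_starForm μ
    simp_rw [h1, Finset.sum_add_distrib] at h2
    have h4 : ∑ a, ∑ c, starCoeff a c * μ c * centered p b Y a =
        ∑ a, w a * centered p b Y a :=
      Finset.sum_congr rfl fun a _ => by rw [hw, Finset.sum_mul]
    have h5 : ∑ a, ∑ c, starCoeff c a * μ a * centered p b Y c =
        ∑ a, w a * centered p b Y a := by
      rw [Finset.sum_comm]; exact h4
    rw [h4, h5] at h2
    linarith
  calc _ ≤ expect (tilt p b) (fun Y => 2 * (∑ a, w a * centered p b Y a) ^ 2 +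
          2⁻¹ * (∑ a, ∑ c, starCoeff a c * (centered p b Y a * centered p b Y c)) ^ 2) := by
        -- `(x + y) ^ 2 ≤ 2 * x ^ 2 + 2 * y ^ 2` makes third moments unnecessary.
        refine expect_mono (tilt_nonneg hp hp1 hb) fun Y => ?_
        rw [hexp]
        nlinarith [sq_nonneg (∑ a, w a * centered p b Y a -
          2⁻¹ * ∑ a, ∑ c, starCoeff a c * (centered p b Y a * centered p b Y c))]
    _ = 2 * ∑ a, w a ^ 2 * arcVar p b a +
          ∑ a, ∑ c, starCoeff a c ^ 2 * (arcVar p b a * arcVar p b c) := by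
        rw [expect_add, expect_const_mul, expect_const_mul, expect_linear_sq,
          expect_quadratic_sq p b _ starCoeff_comm starCoeff_self]
        ring
    _ ≤ 2 * ∑ a, w a ^ 2 * p + ∑ a : VPair n, ∑ c : VPair n, starCoeff a c ^ 2 * (p * p) := by
        gcongr with a _ a _ c _
        · exact hvp a
        · exact hv0 c
        · exact hvp a
        · exact hvp c
    _ = 2 * p * ∑ a, w a ^ 2 + p ^ 2 * ∑ a : VPair n, ∑ c : VPair n, starCoeff a c ^ 2 := by
        simp_rw [← Finset.sum_mul]; ring
    _ ≤ 2 * p * (3 * n * ∑ i, (∑ j, skew μ i j) ^ 2 + 6 * ∑ i, ∑ j, skew μ i j ^ 2) +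
          p ^ 2 * (2 * (n : ℝ) ^ 3) := by
        gcongr
        · exact sum_starCoeff_mul_sq_le μ
        · exact sum_starCoeff_sq_le n
    _ = _ := by ring

/-! ### The mean of the cherry polynomial given the community and its ranking -/

/-- The sign of the comparison of `x` and `y`: `1` if `x < y`, `-1` if `y < x`. -/
def cmpSign {ι : Type*} [LinearOrder ι] (x y : ι) : ℝ :=
  if x < y then 1 else if y < x then -1 else 0

lemma cmpSign_neg {ι : Type*} [LinearOrder ι] (x y : ι) : cmpSign y x = -cmpSign x y := by
  unfold cmpSign
  rcases lt_trichotomy x y with h | h | h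
  · simp [h, h.not_gt]
  · simp [h]
  · simp [h, h.not_gt]

lemma sum_cmpSign_sq {ι : Type*} [LinearOrder ι] (T : Finset ι) :
    ∑ x ∈ T, ∑ y ∈ T, cmpSign x y ^ 2 = (T.card : ℝ) ^ 2 - T.card := by
  have h : ∀ x ∈ T, ∑ y ∈ T, cmpSign x y ^ 2 = (T.card : ℝ) - 1 := by
    intro x hx
    rw [← Finset.add_sum_erase _ _ hx]
    have : ∀ y ∈ T.erase x, cmpSign x y ^ 2 = (1 : ℝ) := by
      intro y hy
      rcases lt_or_gt_of_ne (Finset.ne_of_mem_erase hy) with h | h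
      · simp [cmpSign, h, h.not_gt]
      · simp [cmpSign, h]
    have hpos : 1 ≤ T.card := Finset.card_pos.2 ⟨x, hx⟩
    rw [Finset.sum_congr rfl this, Finset.sum_const, Finset.card_erase_of_mem hx]
    simp [cmpSign, Nat.cast_sub hpos]
  rw [Finset.sum_congr rfl h, Finset.sum_const, nsmul_eq_mul]
  ring

/-- The scores of a transitive tournament are `s - 1, s - 3, …, 1 - s`; this is the sum of their
squares. -/
lemma sum_sq_sum_cmpSign {ι : Type*} [LinearOrder ι] (T : Finset ι) :
    ∑ x ∈ T, (∑ y ∈ T, cmpSign x y) ^ 2 = (T.card : ℝ) * ((T.card : ℝ) ^ 2 - 1) / 3 := by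
  induction T using Finset.induction_on_max with
  | empty => simp
  | insert a T ha ih =>
    have haT : a ∉ T := fun h => lt_irrefl a (ha a h)
    -- Adding a largest element raises all scores by one, so their sum is needed as well.
    have hzero : ∑ x ∈ T, ∑ y ∈ T, cmpSign x y = 0 := by
      have h2 : ∑ x ∈ T, ∑ y ∈ T, cmpSign x y = -∑ x ∈ T, ∑ y ∈ T, cmpSign x y := by
        conv_lhs => rw [Finset.sum_comm]
        rw [← Finset.sum_neg_distrib]
        refine Finset.sum_congr rfl fun x _ => ?_
        rw [← Finset.sum_neg_distrib]
        exact Finset.sum_congr rfl fun y _ => cmpSign_neg _ _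
      linarith
    have hself : cmpSign a a = 0 := by simp [cmpSign]
    have h1 : ∀ x ∈ T, ∑ y ∈ insert a T, cmpSign x y = 1 + ∑ y ∈ T, cmpSign x y := by
      intro x hx
      rw [Finset.sum_insert haT]
      simp [cmpSign, ha x hx]
    have h2 : ∑ y ∈ insert a T, cmpSign a y = -(T.card : ℝ) := by
      rw [Finset.sum_insert haT, hself, zero_add, Finset.sum_congr rfl (g := fun _ => (-1 : ℝ))]
      · simp
      · intro y hy
        simp [cmpSign, ha y hy, (ha y hy).not_gt]
    rw [Finset.sum_insert haT, h2, Finset.sum_congr rfl fun x hx => by rw [h1 x hx],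
      Finset.card_insert_of_notMem haT]
    simp_rw [add_sq, Finset.sum_add_distrib, mul_one, ← Finset.mul_sum, hzero, ih]
    simp
    ring

/-- The matrix of comparisons of the ranks of community members. -/
def rankSign {n : ℕ} (S : Finset (Fin n)) (π : Equiv.Perm S) (i j : Fin n) : ℝ :=
  if h : i ∈ S ∧ j ∈ S then cmpSign (π ⟨i, h.1⟩) (π ⟨j, h.2⟩) else 0

/-- The biases of all pairs given the community and its ranking. -/
def biasVec {n : ℕ} (q : ℝ) (S : Finset (Fin n)) (π : Equiv.Perm S) (e : VPair n) : ℝ :=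
  bias q S π e.1.1 e.1.2

lemma bias_eq_rankSign {n : ℕ} (q : ℝ) (S : Finset (Fin n)) (π : Equiv.Perm S) {i j : Fin n}
    (hij : i ≠ j) : bias q S π i j = q * rankSign S π i j := by
  unfold bias rankSign
  split_ifs with h h1
  · simp [cmpSign, h1]
  · have hne : π ⟨i, h.1⟩ ≠ π ⟨j, h.2⟩ := fun h2 =>
      hij (congrArg Subtype.val (π.injective h2))
    have h2 : π ⟨j, h.2⟩ < π ⟨i, h.1⟩ := lt_of_le_of_ne (not_lt.1 h1) hne.symm
    simp [cmpSign, h1, h2]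
  · simp

lemma skew_arcMean_biasVec {n : ℕ} (p q : ℝ) (S : Finset (Fin n)) (π : Equiv.Perm S)
    (i j : Fin n) : skew (arcMean p (biasVec q S π)) i j = 2 * p * q * rankSign S π i j := by
  have hneg : rankSign S π i j = -rankSign S π j i := by
    unfold rankSign
    by_cases h : i ∈ S ∧ j ∈ S
    · rw [dif_pos h, dif_pos h.symm, ← cmpSign_neg]
    · rw [dif_neg h, dif_neg fun h' => h h'.symm, neg_zero]
  unfold skew arcMean biasVec
  split_ifs with h1 h2
  · rw [bias_eq_rankSign q S π h1.ne]; ring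
  · rw [bias_eq_rankSign q S π h2.ne, hneg]; ring
  · have hij : i = j := le_antisymm (not_lt.1 h2) (not_lt.1 h1)
    subst hij
    have : rankSign S π i i = 0 := by linarith
    rw [this, mul_zero]

lemma sum_rankSign {n : ℕ} (S : Finset (Fin n)) (π : Equiv.Perm S) (F : ℝ → ℝ) (hF : F 0 = 0)
    (i : S) : ∑ j, F (rankSign S π i j) = ∑ y : S, F (cmpSign (π i) y) := by
  rw [← Equiv.sum_comp π, ← Finset.sum_subset (Finset.subset_univ S), ← Finset.sum_coe_sort]
  · refine Finset.sum_congr rfl fun j _ => ?_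
    rw [rankSign, dif_pos ⟨i.2, j.2⟩]
  · intro j _ hj
    rw [rankSign, dif_neg fun h => hj h.2, hF]

lemma rankSign_of_notMem {n : ℕ} {S : Finset (Fin n)} {π : Equiv.Perm S} {i : Fin n}
    (hi : i ∉ S) (j : Fin n) : rankSign S π i j = 0 := dif_neg fun h => hi h.1

lemma sum_sq_sum_rankSign {n : ℕ} (S : Finset (Fin n)) (π : Equiv.Perm S) :
    ∑ i, (∑ j, rankSign S π i j) ^ 2 = (S.card : ℝ) * ((S.card : ℝ) ^ 2 - 1) / 3 := by
  rw [← Finset.sum_subset (Finset.subset_univ S), ← Finset.sum_coe_sort]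
  · simp_rw [sum_rankSign S π (fun x => x) rfl]
    rw [Equiv.sum_comp π (fun x => (∑ y : S, cmpSign x y) ^ 2), sum_sq_sum_cmpSign]
    simp
  · intro i _ hi
    simp [rankSign_of_notMem hi]

lemma sum_rankSign_sq {n : ℕ} (S : Finset (Fin n)) (π : Equiv.Perm S) :
    ∑ i, ∑ j, rankSign S π i j ^ 2 = (S.card : ℝ) ^ 2 - S.card := by
  rw [← Finset.sum_subset (Finset.subset_univ S), ← Finset.sum_coe_sort]
  · simp_rw [sum_rankSign S π (fun x => x ^ 2) (by norm_num)]
    rw [Equiv.sum_comp π (fun x => ∑ y : S, cmpSign x y ^ 2), sum_cmpSign_sq]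
    simp
  · intro i _ hi
    simp [rankSign_of_notMem hi]

lemma sum_sq_sum_skew_arcMean {n : ℕ} (p q : ℝ) (S : Finset (Fin n)) (π : Equiv.Perm S) :
    ∑ i, (∑ j, skew (arcMean p (biasVec q S π)) i j) ^ 2 =
      (2 * p * q) ^ 2 * ((S.card : ℝ) * ((S.card : ℝ) ^ 2 - 1) / 3) := by
  rw [← sum_sq_sum_rankSign S π, Finset.mul_sum]
  refine Finset.sum_congr rfl fun i _ => ?_
  rw [← mul_pow, Finset.mul_sum]
  simp_rw [skew_arcMean_biasVec]

lemma sum_skew_sq_arcMean {n : ℕ} (p q : ℝ) (S : Finset (Fin n)) (π : Equiv.Perm S) :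
    ∑ i, ∑ j, skew (arcMean p (biasVec q S π)) i j ^ 2 =
      (2 * p * q) ^ 2 * ((S.card : ℝ) ^ 2 - S.card) := by
  rw [← sum_rankSign_sq S π, Finset.mul_sum]
  refine Finset.sum_congr rfl fun i _ => ?_
  rw [Finset.mul_sum]
  simp_rw [skew_arcMean_biasVec, mul_pow]

/-- Every triple in the community contributes `(2 p q) ^ 2`, whatever the ranking. -/
lemma starForm_arcMean {n : ℕ} (p q : ℝ) (S : Finset (Fin n)) (π : Equiv.Perm S) :
    starForm (arcMean p (biasVec q S π)) =
      (2 * p * q) ^ 2 * ((S.card : ℝ) * (S.card - 1) * (S.card - 2) / 6) := by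
  rw [starForm, sum_sq_sum_skew_arcMean, sum_skew_sq_arcMean]
  ring

/-- Conditional variance of the cherry polynomial given the community and its ranking. -/
lemma expect_starForm_biasVec_le {n : ℕ} {p q : ℝ} (hp : 0 ≤ p) (hp1 : p ≤ 1) (hq : 0 ≤ q)
    (hq1 : q ≤ 1 / 2) (S : Finset (Fin n)) (π : Equiv.Perm S) :
    expect (tilt p (biasVec q S π))
      (fun Y => (value (starPoly n) Y - starForm (arcMean p (biasVec q S π))) ^ 2) ≤
      56 * n * p ^ 3 * q ^ 2 * (S.card : ℝ) ^ 3 + 2 * p ^ 2 * (n : ℝ) ^ 3 := by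
  simp_rw [value_starPoly]
  refine (expect_starForm_sub_sq_le (b := biasVec q S π) hp hp1
    (fun e => (abs_bias_le hq S π _ _).trans hq1)).trans (add_le_add_left ?_ _)
  rw [sum_sq_sum_skew_arcMean, sum_skew_sq_arcMean]
  have hs : (S.card : ℝ) ^ 2 ≤ n * (S.card : ℝ) ^ 3 := by
    rcases Nat.eq_zero_or_pos S.card with h | h
    · simp [h]
    · have h1 : (1 : ℝ) ≤ S.card := by exact_mod_cast h
      have h2 : (S.card : ℝ) ≤ n := by exact_mod_cast card_finset_fin_le S
      have h3 : (1 : ℝ) ≤ n * S.card := by nlinarith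
      nlinarith [sq_nonneg (S.card : ℝ)]
  have hs0 : (0 : ℝ) ≤ S.card := by positivity
  have h4 : 3 * (n : ℝ) * ((S.card : ℝ) * ((S.card : ℝ) ^ 2 - 1) / 3) +
      6 * ((S.card : ℝ) ^ 2 - S.card) ≤ 7 * (n * (S.card : ℝ) ^ 3) := by
    have : (0 : ℝ) ≤ n * S.card := by positivity
    nlinarith
  calc _ = 2 * p * (2 * p * q) ^ 2 * (3 * (n : ℝ) * ((S.card : ℝ) * ((S.card : ℝ) ^ 2 - 1) / 3) +
        6 * ((S.card : ℝ) ^ 2 - S.card)) := by ring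
    _ ≤ 2 * p * (2 * p * q) ^ 2 * (7 * (n * (S.card : ℝ) ^ 3)) :=
        mul_le_mul_of_nonneg_left h4 (by positivity)
    _ = _ := by ring

/-! ### Strong detection above the threshold -/

lemma prob_eq_expect {n : ℕ} (μ : Dig n → ℝ) (A : Dig n → Bool) (b : Bool) :
    prob μ A b = expect μ (fun Y => if A Y = b then 1 else 0) := by
  simp [prob, expect, Finset.sum_filter]

/-- The size of the community has variance `n r (1 - r)`. -/
lemma sum_communityProb_mul_sq (n : ℕ) (r : ℝ) :
    ∑ S, communityProb n r S * ((S.card : ℝ) - n * r) ^ 2 = n * r * (1 - r) := by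
  have h1 : ∑ S : Finset (Fin n), communityProb n r S * ((S.card : ℝ) - n * r) ^ 2 =
      ∑ S ∈ (Finset.univ : Finset (Fin n)).powerset,
        (fun s : ℕ => r ^ s * (1 - r) ^ (n - s) * ((s : ℝ) - n * r) ^ 2) S.card := by
    rw [Finset.powerset_univ]; rfl
  rw [h1, Finset.sum_powerset_apply_card
    (fun s : ℕ => r ^ s * (1 - r) ^ (n - s) * ((s : ℝ) - n * r) ^ 2), Finset.card_univ, Fintype.card_fin]
  have h2 := congrArg (Polynomial.eval r) (bernsteinPolynomial.variance ℝ n)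
  simp only [Polynomial.eval_finsetSum, Polynomial.eval_mul, Polynomial.eval_pow,
    Polynomial.eval_sub, bernsteinPolynomial, Polynomial.eval_natCast, nsmul_eq_mul,
    Polynomial.eval_X, Polynomial.eval_one] at h2
  rw [← h2]
  exact Finset.sum_congr rfl fun s _ => by rw [nsmul_eq_mul]; ring

/-- False positives: Chebyshev's inequality under the null model. -/
lemma prob_nullProb_le {n : ℕ} {p t : ℝ} (hp : 0 ≤ p) (hp1 : p ≤ 1) (ht : 0 < t)
    (A : Dig n → Bool) (hA : ∀ Y, A Y = true → t ≤ value (starPoly n) Y) :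
    prob (nullProb n p) A true ≤ 2 * p ^ 2 * (n : ℝ) ^ 3 / t ^ 2 := by
  have hvar := expect_starForm_sub_sq_le (n := n) (b := fun _ => 0) hp hp1
    (fun _ => by norm_num)
  have h0 : arcMean p (fun _ : VPair n => (0 : ℝ)) = fun _ => 0 := by
    ext; simp [arcMean]
  have h1 : ∀ i j : Fin n, skew (fun _ => (0 : ℝ)) i j = 0 := fun i j => by simp [skew]
  have h2 : starForm (fun _ : VPair n => (0 : ℝ)) = 0 := by simp [starForm, h1]
  simp only [h0, h1, h2, sub_zero, Finset.sum_const_zero, ne_eq, OfNat.ofNat_ne_zero,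
    not_false_eq_true, zero_pow, mul_zero, add_zero, zero_add] at hvar
  rw [prob_eq_expect, le_div_iff₀ (by positivity), mul_comm, ← expect_const_mul]
  refine le_trans (expect_mono (nullProb_nonneg hp hp1) fun Y => ?_) hvar
  rw [← value_starPoly]
  split_ifs with h
  · rw [mul_one]
    exact pow_le_pow_left₀ ht.le (hA Y h) 2
  · rw [mul_zero]; positivity

/-- False negatives: Chebyshev's inequality for the size of the community, and for the cherry
polynomial given the community and its ranking. -/
lemma prob_plantedProb_le {n : ℕ} {k p q t : ℝ} (hn : 1 ≤ n) (hp : 0 < p) (hp1 : p ≤ 1)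
    (hq : 0 < q) (hq1 : q ≤ 1 / 2) (hk : 16 ≤ k) (hkn : k ≤ n)
    (ht : t ≤ p ^ 2 * q ^ 2 * k ^ 3 / 48) (A : Dig n → Bool)
    (hA : ∀ Y, A Y = false → value (starPoly n) Y ≤ t) :
    prob (plantedProb n k p q) A false ≤ 4 / k +
      (448 * n * p ^ 3 * q ^ 2 * k ^ 3 + 2 * p ^ 2 * (n : ℝ) ^ 3) /
        (p ^ 2 * q ^ 2 * k ^ 3 / 48) ^ 2 := by
  have hn0 : (0 : ℝ) < n := by exact_mod_cast hn
  have hk0 : 0 < k := by linarith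
  have hr0 : 0 ≤ k / n := by positivity
  have hr1 : k / n ≤ 1 := (div_le_one hn0).2 hkn
  set τ := p ^ 2 * q ^ 2 * k ^ 3 / 48 with hτ
  have hτ0 : 0 < τ := by positivity
  set E := (448 * n * p ^ 3 * q ^ 2 * k ^ 3 + 2 * p ^ 2 * (n : ℝ) ^ 3) / τ ^ 2 with hE
  have hE0 : 0 ≤ E := by positivity
  have hcond : ∀ (S : Finset (Fin n)) (π : Equiv.Perm S),
      expect (tilt p (biasVec q S π)) (fun Y => if A Y = false then 1 else 0) ≤
        4 / k ^ 2 * ((S.card : ℝ) - k) ^ 2 + E := by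
    intro S π
    have htilt := tilt_nonneg (n := n) (b := biasVec q S π) hp.le hp1
      (fun e => (abs_bias_le hq.le S π _ _).trans hq1)
    -- For a community of atypical size the first term on the right exceeds `1`; otherwise the
    -- conditional mean of the polynomial is at least twice `τ`, hence exceeds `t` by at least `τ`.
    by_cases hS : |(S.card : ℝ) - k| ≤ k / 2
    · obtain ⟨hS1, hS2⟩ := abs_le.1 hS
      set m := starForm (arcMean p (biasVec q S π)) with hm
      have hm2 : 2 * τ ≤ m := by
        rw [hm, starForm_arcMean]
        set s : ℝ := (S.card : ℝ) with hs
        have hs8 : k / 2 ≤ s := by linarith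
        have h8 : 8 ≤ s := by linarith
        have h1 : s ^ 3 / 2 ≤ s * (s - 1) * (s - 2) := by nlinarith [mul_self_nonneg s]
        have h2 : (k / 2) ^ 3 ≤ s ^ 3 := pow_le_pow_left₀ (by positivity) hs8 3
        calc 2 * τ = (2 * p * q) ^ 2 * ((k / 2) ^ 3 / 12) := by rw [hτ]; ring
          _ ≤ (2 * p * q) ^ 2 * (s * (s - 1) * (s - 2) / 6) :=
              mul_le_mul_of_nonneg_left (by linarith) (by positivity)
      have hvar := expect_starForm_biasVec_le hp.le hp1 hq.le hq1 S π
      have hV : 56 * n * p ^ 3 * q ^ 2 * (S.card : ℝ) ^ 3 ≤ 448 * n * p ^ 3 * q ^ 2 * k ^ 3 := by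
        have h2 : (S.card : ℝ) ^ 3 ≤ (2 * k) ^ 3 :=
          pow_le_pow_left₀ (by positivity) (by linarith) 3
        calc _ ≤ 56 * n * p ^ 3 * q ^ 2 * (2 * k) ^ 3 :=
              mul_le_mul_of_nonneg_left h2 (by positivity)
          _ = _ := by ring
      have h3 : expect (tilt p (biasVec q S π)) (fun Y => if A Y = false then 1 else 0) ≤ E := by
        rw [hE, le_div_iff₀ (by positivity), mul_comm, ← expect_const_mul]
        refine le_trans (expect_mono htilt fun Y => ?_) (hvar.trans (add_le_add_left hV _))
        split_ifs with h
        · rw [mul_one]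
          have h4 := hA Y h
          have h5 : τ ≤ m - value (starPoly n) Y := by linarith
          rw [← neg_sub, neg_sq]
          exact pow_le_pow_left₀ hτ0.le h5 2
        · rw [mul_zero]; positivity
      have : (0 : ℝ) ≤ 4 / k ^ 2 * ((S.card : ℝ) - k) ^ 2 := by positivity
      linarith
    · have h1 : expect (tilt p (biasVec q S π)) (fun Y => if A Y = false then 1 else 0) ≤ 1 := by
        refine (expect_mono htilt fun Y => ?_).trans_eq (expect_tilt_one p (biasVec q S π))
        split_ifs <;> norm_num
      have h2 : 1 ≤ 4 / k ^ 2 * ((S.card : ℝ) - k) ^ 2 := by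
        have h3 := pow_le_pow_left₀ (by positivity) (not_le.1 hS).le 2
        rw [sq_abs] at h3
        calc (1 : ℝ) = 4 / k ^ 2 * (k / 2) ^ 2 := by field_simp; norm_num
          _ ≤ _ := mul_le_mul_of_nonneg_left h3 (by positivity)
      linarith
  rw [prob_eq_expect, expect_plantedProb]
  calc _ ≤ ∑ S, communityProb n (k / n) S * (4 / k ^ 2 * ((S.card : ℝ) - k) ^ 2 + E) := by
        refine Finset.sum_le_sum fun S _ =>
          mul_le_mul_of_nonneg_left ?_ (communityProb_nonneg hr0 hr1 S)
        rw [← sum_perm_const n S (4 / k ^ 2 * ((S.card : ℝ) - k) ^ 2 + E)]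
        exact mul_le_mul_of_nonneg_left (Finset.sum_le_sum fun π _ => hcond S π) (by positivity)
    _ = 4 / k ^ 2 * ∑ S, communityProb n (k / n) S * ((S.card : ℝ) - n * (k / n)) ^ 2 + E := by
        rw [mul_div_cancel₀ _ hn0.ne']
        simp_rw [mul_add, Finset.sum_add_distrib, ← Finset.sum_mul, sum_communityProb, one_mul,
          Finset.mul_sum]
        congr 1
        exact Finset.sum_congr rfl fun S _ => by ring
    _ ≤ 4 / k ^ 2 * k + E := by
        rw [sum_communityProb_mul_sq, mul_div_cancel₀ _ hn0.ne']
        gcongr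
        nlinarith
    _ = 4 / k + E := by congr 1; field_simp

lemma plantedProb_nonneg {n : ℕ} {k p q : ℝ} (hp : 0 ≤ p) (hp1 : p ≤ 1) (hq : 0 ≤ q)
    (hq1 : q ≤ 1 / 2) (hr0 : 0 ≤ k / n) (hr1 : k / n ≤ 1) (Y : Dig n) :
    0 ≤ plantedProb n k p q Y :=
  Finset.sum_nonneg fun S _ => mul_nonneg (communityProb_nonneg hr0 hr1 S)
    (mul_nonneg (by positivity) (Finset.sum_nonneg fun π _ =>
      tilt_nonneg (b := biasVec q S π) hp hp1
        (fun e => (abs_bias_le hq S π _ _).trans hq1) Y))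

/-- Above the threshold, the cherry polynomial with threshold `n ^ θ` detects strongly whenever
`n ^ θ` lies between the null standard deviation and the planted mean. -/
lemma strongDetection_starPoly {α β γ θ : ℝ} (hα : 0 < α) (hβ : 0 < β) (hβ1 : β ≤ 1)
    (hγ : 0 < γ) (hlo : 3 / 2 - γ < θ) (hhi : θ < 3 * β - 2 * γ - 2 * α) :
    StrongDetection (nullLD γ) (plantedLD α β γ)
      (thresholdTest starPoly fun n => (n : ℝ) ^ θ) := by
  have hpow : ∀ {x : ℝ}, 0 < x → Tendsto (fun n : ℕ => (n : ℝ) ^ (-x)) atTop (𝓝 0) :=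
    fun hx => (tendsto_rpow_neg_atTop hx).comp tendsto_natCast_atTop_atTop
  have hq := (hpow hα).eventually (eventually_le_nhds (show (0 : ℝ) < 1 / 2 by norm_num))
  have hk : ∀ᶠ n : ℕ in atTop, 16 ≤ (n : ℝ) ^ β :=
    ((tendsto_rpow_atTop hβ).comp tendsto_natCast_atTop_atTop).eventually_ge_atTop 16
  have ht := (hpow (x := 3 * β - 2 * γ - 2 * α - θ) (by linarith)).eventually
    (eventually_le_nhds (show (0 : ℝ) < 1 / 48 by norm_num))
  have hlim : Tendsto (fun n : ℕ => 2 * (n : ℝ) ^ (-(2 * θ + 2 * γ - 3)) +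
      (4 * (n : ℝ) ^ (-β) + (48 ^ 2 * 448 * (n : ℝ) ^ (-(3 * β - γ - 2 * α - 1)) +
        48 ^ 2 * 2 * (n : ℝ) ^ (-(6 * β - 2 * γ - 4 * α - 3))))) atTop (𝓝 0) := by
    have h := ((hpow (x := 2 * θ + 2 * γ - 3) (by linarith)).const_mul 2).add
      (((hpow hβ).const_mul 4).add
        (((hpow (x := 3 * β - γ - 2 * α - 1) (by linarith)).const_mul (48 ^ 2 * 448)).add
        ((hpow (x := 6 * β - 2 * γ - 4 * α - 3) (by linarith)).const_mul (48 ^ 2 * 2))))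
    simpa using h
  unfold StrongDetection
  refine squeeze_zero' ?_ ?_ hlim
  · filter_upwards [hq, eventually_ge_atTop 1] with n hqn hn
    have hn1 : (1 : ℝ) ≤ n := by exact_mod_cast hn
    have hp0 : (0 : ℝ) ≤ (n : ℝ) ^ (-γ) := by positivity
    have hp1 : (n : ℝ) ^ (-γ) ≤ 1 := Real.rpow_le_one_of_one_le_of_nonpos hn1 (by linarith)
    have hr1 : (n : ℝ) ^ β / n ≤ 1 := (div_le_one (by linarith)).2
      (by simpa using Real.rpow_le_rpow_of_exponent_le hn1 hβ1)
    exact add_nonneg (Finset.sum_nonneg fun Y _ => nullProb_nonneg hp0 hp1 Y)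
      (Finset.sum_nonneg fun Y _ =>
        plantedProb_nonneg hp0 hp1 (by positivity) hqn (by positivity) hr1 Y)
  · filter_upwards [hq, hk, ht, eventually_ge_atTop 1] with n hqn hkn htn hn
    have hn1 : (1 : ℝ) ≤ n := by exact_mod_cast hn
    have hn0 : (0 : ℝ) < n := by linarith
    have hp0 : (0 : ℝ) < (n : ℝ) ^ (-γ) := by positivity
    have hp1 : (n : ℝ) ^ (-γ) ≤ 1 := Real.rpow_le_one_of_one_le_of_nonpos hn1 (by linarith)
    have hτ : ((n : ℝ) ^ (-γ)) ^ 2 * ((n : ℝ) ^ (-α)) ^ 2 * ((n : ℝ) ^ β) ^ 3 =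
        (n : ℝ) ^ (3 * β - 2 * γ - 2 * α) := by
      simp_rw [← Real.rpow_natCast, ← Real.rpow_mul hn0.le, ← Real.rpow_add hn0]
      push_cast
      ring_nf
    have h1 := prob_nullProb_le (t := (n : ℝ) ^ θ) hp0.le hp1 (by positivity)
      (thresholdTest starPoly (fun n => (n : ℝ) ^ θ) n) (fun Y h => of_decide_eq_true h)
    have h2 := prob_plantedProb_le (k := (n : ℝ) ^ β) (p := (n : ℝ) ^ (-γ))
      (q := (n : ℝ) ^ (-α)) (t := (n : ℝ) ^ θ) hn hp0 hp1 (by positivity) hqn hkn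
      (by simpa using Real.rpow_le_rpow_of_exponent_le hn1 hβ1)
      (by
        rw [hτ, show (3 * β - 2 * γ - 2 * α : ℝ) = (3 * β - 2 * γ - 2 * α - θ) + θ by ring,
          Real.rpow_add hn0]
        rw [Real.rpow_neg hn0.le] at htn
        have h3 : (48 : ℝ) ≤ (n : ℝ) ^ (3 * β - 2 * γ - 2 * α - θ) := by
          have := inv_le_of_inv_le₀ (by positivity) htn
          simpa using this
        have h4 : (0 : ℝ) < (n : ℝ) ^ θ := by positivity
        nlinarith)
      (thresholdTest starPoly (fun n => (n : ℝ) ^ θ) n)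
      (fun Y h => (not_le.1 (of_decide_eq_false h)).le)
    refine (add_le_add h1 h2).trans (le_of_eq ?_)
    have e1 : 2 * ((n : ℝ) ^ (-γ)) ^ 2 * (n : ℝ) ^ 3 / ((n : ℝ) ^ θ) ^ 2 =
        2 * (n : ℝ) ^ (-(2 * θ + 2 * γ - 3)) := by
      rw [mul_assoc, mul_div_assoc]
      simp_rw [← Real.rpow_natCast, ← Real.rpow_mul hn0.le, ← Real.rpow_add hn0,
        ← Real.rpow_sub hn0]
      push_cast
      ring_nf
    have e2 : 4 / (n : ℝ) ^ β = 4 * (n : ℝ) ^ (-β) := by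
      rw [Real.rpow_neg hn0.le, div_eq_mul_inv]
    have e3 : (n : ℝ) * ((n : ℝ) ^ (-γ)) ^ 3 * ((n : ℝ) ^ (-α)) ^ 2 * ((n : ℝ) ^ β) ^ 3 =
        (n : ℝ) ^ (1 - 3 * γ - 2 * α + 3 * β) := by
      nth_rewrite 1 [← Real.rpow_one (n : ℝ)]
      simp_rw [← Real.rpow_natCast, ← Real.rpow_mul hn0.le, ← Real.rpow_add hn0]
      push_cast
      ring_nf
    have e4 : ((n : ℝ) ^ (-γ)) ^ 2 * (n : ℝ) ^ 3 = (n : ℝ) ^ (3 - 2 * γ) := by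
      simp_rw [← Real.rpow_natCast, ← Real.rpow_mul hn0.le, ← Real.rpow_add hn0]
      push_cast
      ring_nf
    have e5 : ((n : ℝ) ^ (3 * β - 2 * γ - 2 * α)) ^ 2 =
        (n : ℝ) ^ (6 * β - 4 * γ - 4 * α) := by
      rw [← Real.rpow_natCast, ← Real.rpow_mul hn0.le]
      push_cast
      ring_nf
    have e6 : (448 * n * ((n : ℝ) ^ (-γ)) ^ 3 * ((n : ℝ) ^ (-α)) ^ 2 * ((n : ℝ) ^ β) ^ 3 +
        2 * ((n : ℝ) ^ (-γ)) ^ 2 * (n : ℝ) ^ 3) /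
        (((n : ℝ) ^ (-γ)) ^ 2 * ((n : ℝ) ^ (-α)) ^ 2 * ((n : ℝ) ^ β) ^ 3 / 48) ^ 2 =
        48 ^ 2 * 448 * ((n : ℝ) ^ (1 - 3 * γ - 2 * α + 3 * β) /
          (n : ℝ) ^ (6 * β - 4 * γ - 4 * α)) +
        48 ^ 2 * 2 * ((n : ℝ) ^ (3 - 2 * γ) / (n : ℝ) ^ (6 * β - 4 * γ - 4 * α)) := by
      rw [hτ, div_pow, e5, ← e3, ← e4]
      field_simp
    rw [e1, e2, e6, ← Real.rpow_sub hn0, ← Real.rpow_sub hn0]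
    ring_nf

/-! ### Total correctness of machine programs -/

/-- Started in memory `m`, the program `P` halts within `T` steps in a memory satisfying `Q`. -/
def Ends (x : ℕ → ℕ → ℕ) (P : Program) (m : ℕ → ℕ) (T : ℕ) (Q : (ℕ → ℕ) → Prop) : Prop :=
  ∃ m' t, Runs x P m m' t ∧ t ≤ T ∧ Q m'

section Rules

variable {x : ℕ → ℕ → ℕ} {m : ℕ → ℕ} {Q : (ℕ → ℕ) → Prop}

lemma Ends.mono {P : Program} {T T' : ℕ} {Q' : (ℕ → ℕ) → Prop} (h : Ends x P m T Q)
    (hT : T ≤ T') (hQ : ∀ m', Q m' → Q' m') : Ends x P m T' Q' := by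
  obtain ⟨m', t, h1, h2, h3⟩ := h
  exact ⟨m', t, h1, h2.trans hT, hQ _ h3⟩

lemma Ends.weaken {P : Program} {T T' : ℕ} (h : Ends x P m T Q) (hT : T ≤ T') :
    Ends x P m T' Q :=
  h.mono hT fun _ h => h

lemma Ends.const {d c : ℕ} (h : Q (Function.update m d c)) : Ends x (.const d c) m 1 Q :=
  ⟨_, _, .const d c m, le_rfl, h⟩

lemma Ends.add {d a b : ℕ} (h : Q (Function.update m d (m a + m b))) :
    Ends x (.add d a b) m 1 Q :=
  ⟨_, _, .add d a b m, le_rfl, h⟩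

lemma Ends.sub {d a b : ℕ} (h : Q (Function.update m d (m a - m b))) :
    Ends x (.sub d a b) m 1 Q :=
  ⟨_, _, .sub d a b m, le_rfl, h⟩

lemma Ends.read {d i j : ℕ} (h : Q (Function.update m d (x (m i) (m j)))) :
    Ends x (.read d i j) m 1 Q :=
  ⟨_, _, .read d i j m, le_rfl, h⟩

lemma Ends.seq {P R : Program} {S T : ℕ} (h : Ends x P m S fun m' => Ends x R m' T Q) :
    Ends x (.seq P R) m (S + T) Q := by
  obtain ⟨m', s, h1, h2, m'', t, h3, h4, h5⟩ := h
  exact ⟨m'', s + t, .seq h1 h3, add_le_add h2 h4, h5⟩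

lemma Ends.branch {a : ℕ} {P R : Program} {T : ℕ} (h1 : m a ≠ 0 → Ends x P m T Q)
    (h0 : m a = 0 → Ends x R m T Q) : Ends x (.branch a P R) m (T + 1) Q := by
  by_cases ha : m a = 0
  · obtain ⟨m', t, h2, h3, h4⟩ := h0 ha
    exact ⟨m', t + 1, .branch_zero ha h2, by omega, h4⟩
  · obtain ⟨m', t, h2, h3, h4⟩ := h1 ha
    exact ⟨m', t + 1, .branch_pos ha h2, by omega, h4⟩

/-- A loop whose body decrements the loop variable. -/
lemma Ends.loop {a : ℕ} {P : Program} {T : ℕ} (I : ℕ → (ℕ → ℕ) → Prop)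
    (hbody : ∀ v m, m a = v + 1 → I (v + 1) m → Ends x P m T fun m' => m' a = v ∧ I v m')
    (v : ℕ) : ∀ m, m a = v → I v m → Ends x (.loop a P) m (v * (T + 1) + 1) (I 0) := by
  induction v with
  | zero => exact fun m hm hI => ⟨m, 1, .loop_zero hm, by omega, hI⟩
  | succ v ih =>
    intro m hm hI
    obtain ⟨m₁, s, h1, h2, h3, h4⟩ := hbody v m hm hI
    obtain ⟨m₂, t, h5, h6, h7⟩ := ih m₁ h3 h4
    refine ⟨m₂, s + t + 1, .loop_pos (by omega) h1 h5, ?_, h7⟩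
    rw [add_mul]
    omega

end Rules

/-! ### Counting cherries -/

/-- Indicator that the entries `(i, j)` and `(i, k)` are nonzero and equal. -/
def agree (x : ℕ → ℕ → ℕ) (i j k : ℕ) : ℕ :=
  if x i j ≠ 0 ∧ x i k ≠ 0 ∧ x i j = x i k then 1 else 0

/-- Indicator that the entries `(i, j)` and `(i, k)` are nonzero and different. -/
def disagree (x : ℕ → ℕ → ℕ) (i j k : ℕ) : ℕ :=
  if x i j ≠ 0 ∧ x i k ≠ 0 ∧ x i j ≠ x i k then 1 else 0

/-- The sum of `c i j k` over `i < w`, `j < n` and `k < j`. -/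
def cherrySumBelow (c : ℕ → ℕ → ℕ → ℕ) (n w : ℕ) : ℕ :=
  ∑ i ∈ Finset.range w, ∑ j ∈ Finset.range n, ∑ k ∈ Finset.range j, c i j k

/-- The sum of `c i j k` over `i, j < n` and `k < j`. -/
def cherrySum (c : ℕ → ℕ → ℕ → ℕ) (n : ℕ) : ℕ := cherrySumBelow c n n

/-- Register layout during counting: `0` holds `n`; `1`, `2` hold loop variables; `6`, `7` hold
the two counters; `8` holds the constant one; `17` holds the constant zero. -/
def CountState (n i j s d : ℕ) (m : ℕ → ℕ) : Prop :=
  m 0 = n ∧ m 1 = i ∧ m 2 = j ∧ m 6 = s ∧ m 7 = d ∧ m 8 = 1 ∧ m 17 = 0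

/-- Compare the entries `(i, j)` and `(i, k)`, where `k + 1` is the value of cell `3`. As
subtraction is truncated, cell `9` receives the absolute difference of the two entries. The
instruction `.const 9 0` serves as an empty branch. -/
def compareBody : Program :=
  .seq (.sub 3 3 8) <| .seq (.read 4 1 2) <| .seq (.read 5 1 3) <|
    .branch 4 (.branch 5
      (.seq (.sub 9 4 5) <| .seq (.sub 10 5 4) <| .seq (.add 9 9 10) <|
        .branch 9 (.add 7 7 8) (.add 6 6 8))
      (.const 9 0)) (.const 9 0)

/-- Loop over `k < j`. -/
def innerBody : Program := .seq (.sub 2 2 8) <| .seq (.add 3 2 17) (.loop 3 compareBody)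

/-- Loop over `j < n`. -/
def outerBody : Program := .seq (.sub 1 1 8) <| .seq (.add 2 0 17) (.loop 2 innerBody)

/-- Compute the numbers of cherries with equal and with different signs in cells `6` and `7`. -/
def countProgram : Program :=
  .seq (.const 8 1) <| .seq (.add 1 0 17) (.loop 1 outerBody)

lemma ends_compareBody {x : ℕ → ℕ → ℕ} {n i j s d v : ℕ} {m : ℕ → ℕ} (h3 : m 3 = v + 1)
    (hm : CountState n i j s d m) :
    Ends x compareBody m 10 fun m' =>
      m' 3 = v ∧ CountState n i j (s + agree x i j v) (d + disagree x i j v) m' := by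
  obtain ⟨g0, g1, g2, g6, g7, g8, g17⟩ := hm
  have hsub : ∀ a b : ℕ, a - b + (b - a) = 0 ↔ a = b := fun a b => by omega
  refine Ends.weaken (T := 1 + (1 + (1 + (1 + (1 + (1 + (1 + 1))) + 1 + 1)))) ?_ (by omega)
  refine Ends.seq (Ends.sub (Ends.seq (Ends.read (Ends.seq (Ends.read ?_)))))
  refine Ends.branch (fun h4 => ?_) fun h4 => ?_
  · refine Ends.branch (fun h5 => ?_) fun h5 => ?_
    · refine Ends.seq (Ends.sub (Ends.seq (Ends.sub (Ends.seq (Ends.add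
        (Ends.branch (fun h9 => Ends.add ?_) fun h9 => Ends.add ?_))))))
      · simp [g1, g2, h3, g8] at h4 h5 h9
        have hne : x i j ≠ x i v := fun h => by omega
        simp [CountState, agree, disagree, *]
      · simp [g1, g2, h3, g8] at h4 h5 h9
        have heq : x i j = x i v := by omega
        simp [heq] at h4
        simp [CountState, agree, disagree, *]
    · refine Ends.weaken (T := 1) (Ends.const ?_) (by omega)
      simp [g1, g2, h3, g8] at h4 h5
      simp [CountState, agree, disagree, *]
  · refine Ends.weaken (T := 1) (Ends.const ?_) (by omega)
    simp [g1, g2, h3, g8] at h4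
    simp [CountState, agree, disagree, *]

lemma ends_innerBody {x : ℕ → ℕ → ℕ} {n i s d v : ℕ} {m : ℕ → ℕ} (hv : v < n)
    (hm : CountState n i (v + 1) s d m) :
    Ends x innerBody m (11 * n + 3) fun m' => CountState n i v
      (s + ∑ k ∈ Finset.range v, agree x i v k) (d + ∑ k ∈ Finset.range v, disagree x i v k)
      m' := by
  obtain ⟨g0, g1, g2, g6, g7, g8, g17⟩ := hm
  refine Ends.weaken (T := 1 + (1 + (v * 11 + 1))) ?_ (by omega)
  refine Ends.seq (Ends.sub (Ends.seq (Ends.add ?_)))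
  -- The loop variable counts down: counter plus remaining sum is invariant.
  refine (Ends.loop (T := 10) (fun w m' => ∃ s' d', CountState n i v s' d' m' ∧
    s' + ∑ k ∈ Finset.range w, agree x i v k = s + ∑ k ∈ Finset.range v, agree x i v k ∧
    d' + ∑ k ∈ Finset.range w, disagree x i v k = d + ∑ k ∈ Finset.range v, disagree x i v k)
    ?_ v _ ?_ ?_).mono le_rfl ?_
  · rintro w m' hw ⟨s', d', hst, h1, h2⟩
    refine (ends_compareBody hw hst).mono le_rfl fun m'' h => ⟨h.1, _, _, h.2, ?_, ?_⟩
    · rw [← h1, Finset.sum_range_succ]; ring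
    · rw [← h2, Finset.sum_range_succ]; ring
  · simp [*]
  · exact ⟨s, d, by simp [CountState, *], rfl, rfl⟩
  · rintro m' ⟨s', d', hst, h1, h2⟩
    rw [Finset.sum_range_zero, add_zero] at h1 h2
    rwa [← h1, ← h2]

lemma ends_outerBody {x : ℕ → ℕ → ℕ} {n j s d v : ℕ} {m : ℕ → ℕ}
    (hm : CountState n (v + 1) j s d m) :
    Ends x outerBody m (n * (11 * n + 4) + 3) fun m' => CountState n v 0
      (s + ∑ j ∈ Finset.range n, ∑ k ∈ Finset.range j, agree x v j k)
      (d + ∑ j ∈ Finset.range n, ∑ k ∈ Finset.range j, disagree x v j k) m' := by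
  obtain ⟨g0, g1, g2, g6, g7, g8, g17⟩ := hm
  refine Ends.weaken (T := 1 + (1 + (n * (11 * n + 4) + 1))) ?_ (by omega)
  refine Ends.seq (Ends.sub (Ends.seq (Ends.add ?_)))
  refine (Ends.loop (T := 11 * n + 3) (fun w m' => w ≤ n ∧ ∃ s' d', CountState n v w s' d' m' ∧
    s' + ∑ j ∈ Finset.range w, ∑ k ∈ Finset.range j, agree x v j k =
      s + ∑ j ∈ Finset.range n, ∑ k ∈ Finset.range j, agree x v j k ∧
    d' + ∑ j ∈ Finset.range w, ∑ k ∈ Finset.range j, disagree x v j k =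
      d + ∑ j ∈ Finset.range n, ∑ k ∈ Finset.range j, disagree x v j k)
    ?_ n _ ?_ ?_).mono le_rfl ?_
  · rintro w m' hw ⟨hwn, s', d', hst, h1, h2⟩
    refine (ends_innerBody (by omega) hst).mono le_rfl
      fun m'' h => ⟨h.2.2.1, by omega, _, _, h, ?_, ?_⟩
    · rw [← h1, Finset.sum_range_succ]; ring
    · rw [← h2, Finset.sum_range_succ]; ring
  · simp [*]
  · exact ⟨le_rfl, s, d, by simp [CountState, *], rfl, rfl⟩
  · rintro m' ⟨-, s', d', hst, h1, h2⟩
    rw [Finset.sum_range_zero, add_zero] at h1 h2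
    rwa [← h1, ← h2]

lemma ends_countProgram (x : ℕ → ℕ → ℕ) (n : ℕ) :
    Ends x countProgram (Function.update (fun _ => 0) 0 n)
      (n * (n * (11 * n + 4) + 4) + 3) fun m' =>
        CountState n 0 0 (cherrySum (agree x) n) (cherrySum (disagree x) n) m' := by
  refine Ends.weaken (T := 1 + (1 + (n * (n * (11 * n + 4) + 4) + 1))) ?_ (by omega)
  refine Ends.seq (Ends.const (Ends.seq (Ends.add ?_)))
  refine (Ends.loop (T := n * (11 * n + 4) + 3) (fun w m' => ∃ s' d',
    CountState n w 0 s' d' m' ∧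
    s' + cherrySumBelow (agree x) n w = cherrySum (agree x) n ∧
    d' + cherrySumBelow (disagree x) n w = cherrySum (disagree x) n)
    ?_ n _ ?_ ?_).mono le_rfl ?_
  · rintro w m' hw ⟨s', d', hst, h1, h2⟩
    refine (ends_outerBody hst).mono le_rfl fun m'' h => ⟨h.2.1, _, _, h, ?_, ?_⟩
    · rw [← h1, cherrySumBelow, cherrySumBelow, Finset.sum_range_succ]; ring
    · rw [← h2, cherrySumBelow, cherrySumBelow, Finset.sum_range_succ]; ring
  · simp
  · exact ⟨0, 0, by simp [CountState], by
      simp [cherrySumBelow, cherrySum], by simp [cherrySumBelow, cherrySum]⟩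
  · rintro m' ⟨s', d', hst, h1, h2⟩
    rw [cherrySumBelow, Finset.sum_range_zero, add_zero] at h1 h2
    rwa [← h1, ← h2]

lemma cherrySum_le {c : ℕ → ℕ → ℕ → ℕ} (hc : ∀ i j k, c i j k ≤ 1) (n : ℕ) :
    cherrySum c n ≤ n ^ 3 := by
  calc cherrySumBelow c n n ≤ ∑ _i ∈ Finset.range n, ∑ _j ∈ Finset.range n, n := by
        refine Finset.sum_le_sum fun i _ => Finset.sum_le_sum fun j hj => ?_
        calc _ ≤ ∑ _k ∈ Finset.range j, 1 := Finset.sum_le_sum fun k _ => hc i j k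
          _ ≤ n := by simpa using (Finset.mem_range.1 hj).le
    _ = n ^ 3 := by simp; ring

/-! ### Powers and the threshold test -/

/-- Multiply cell `13` by cell `12`, by repeated addition. -/
def mulProgram : Program :=
  .seq (.const 15 0) <| .seq (.add 14 12 17) <|
    .seq (.loop 14 (.seq (.sub 14 14 8) (.add 15 15 13))) (.add 13 15 17)

/-- Compute the `b`-th power of cell `12` in cell `13`. -/
def powProgram : ℕ → Program
  | 0 => .const 13 1
  | b + 1 => .seq (powProgram b) mulProgram

/-- Register layout while computing powers: `0` holds `n`; `12` holds the base; `16` holds the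
result of an earlier computation; `8` and `17` hold one and zero. -/
def PowState (n f g : ℕ) (m : ℕ → ℕ) : Prop :=
  m 0 = n ∧ m 8 = 1 ∧ m 12 = f ∧ m 16 = g ∧ m 17 = 0

lemma ends_mulProgram {x : ℕ → ℕ → ℕ} {n f g y : ℕ} {m : ℕ → ℕ} (hm : PowState n f g m)
    (hy : m 13 = y) :
    Ends x mulProgram m (3 * f + 4) fun m' => PowState n f g m' ∧ m' 13 = f * y := by
  obtain ⟨g0, g8, g12, g16, g17⟩ := hm
  refine Ends.weaken (T := 1 + (1 + (f * 3 + 1 + 1))) ?_ (by omega)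
  refine Ends.seq (Ends.const (Ends.seq (Ends.add (Ends.seq ?_))))
  refine (Ends.loop (T := 2) (fun w m' => PowState n f g m' ∧ m' 13 = y ∧
    m' 15 + w * y = f * y) ?_ f _ ?_ ?_).mono le_rfl ?_
  · rintro w m' hw ⟨⟨k0, k8, k12, k16, k17⟩, k13, k15⟩
    refine Ends.seq (Ends.sub (Ends.add ?_))
    simp [PowState, *]
    rw [← k15]
    ring
  · simp [*]
  · simp [PowState, *]
  · rintro m' ⟨⟨k0, k8, k12, k16, k17⟩, k13, k15⟩
    refine Ends.add ?_
    rw [zero_mul, add_zero] at k15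
    simp [PowState, *]

lemma ends_powProgram {x : ℕ → ℕ → ℕ} {n f g : ℕ} {m : ℕ → ℕ} (hm : PowState n f g m) (b : ℕ) :
    Ends x (powProgram b) m (b * (3 * f + 4) + 1) fun m' =>
      PowState n f g m' ∧ m' 13 = f ^ b := by
  induction b with
  | zero =>
    obtain ⟨g0, g8, g12, g16, g17⟩ := hm
    refine Ends.weaken (T := 1) (Ends.const ?_) (by omega)
    simp [PowState, *]
  | succ b ih =>
    refine (Ends.seq (ih.mono le_rfl fun m' h => ends_mulProgram h.1 h.2)).mono
      (by rw [add_mul]; omega) fun m' h => ⟨h.1, ?_⟩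
    rw [h.2, pow_succ, mul_comm]

/-- Decide whether `n ^ a ≤ f ^ b`, where `f` is the positive part of the cherry polynomial. -/
def thresholdProgram (a b : ℕ) : Program :=
  .seq countProgram <| .seq (.sub 12 6 7) <| .seq (powProgram b) <| .seq (.add 16 13 17) <|
    .seq (.add 12 0 17) <| .seq (powProgram a) <| .seq (.sub 9 13 16) <|
      .branch 9 (.const 0 0) (.const 0 1)

lemma ends_thresholdProgram (x : ℕ → ℕ → ℕ) (n a b : ℕ) :
    Ends x (thresholdProgram a b) (Function.update (fun _ => 0) 0 n)
      (n * (n * (11 * n + 4) + 4) + 11 + b * (3 * n ^ 3 + 4) + a * (3 * n + 4)) fun m' =>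
        m' 0 = if n ^ a ≤ (cherrySum (agree x) n - cherrySum (disagree x) n) ^ b
          then 1 else 0 := by
  set f := cherrySum (agree x) n - cherrySum (disagree x) n with hf
  have hfn : f ≤ n ^ 3 := (Nat.sub_le _ _).trans
    (cherrySum_le (fun i j k => by unfold agree; split_ifs <;> omega) n)
  have hmul : b * (3 * f + 4) ≤ b * (3 * n ^ 3 + 4) := Nat.mul_le_mul_left _ (by omega)
  refine Ends.weaken (T := n * (n * (11 * n + 4) + 4) + 3 + (1 + (b * (3 * f + 4) + 1 +
    (1 + (1 + (a * (3 * n + 4) + 1 + (1 + (1 + 1)))))))) ?_ (by omega)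
  refine Ends.seq ((ends_countProgram x n).mono le_rfl fun m₁ h₁ => Ends.seq (Ends.sub ?_))
  obtain ⟨g0, g1, g2, g6, g7, g8, g17⟩ := h₁
  have h2 : PowState n f (m₁ 16) (Function.update m₁ 12 (m₁ 6 - m₁ 7)) := by
    simp [PowState, *]
  refine Ends.seq ((ends_powProgram h2 b).mono le_rfl fun m₃ h₃ => Ends.seq (Ends.add
    (Ends.seq (Ends.add (Ends.seq ?_)))))
  obtain ⟨⟨k0, k8, k12, k16, k17⟩, k13⟩ := h₃
  refine (ends_powProgram (n := n) (f := n) (g := f ^ b) ?_ a).mono le_rfl fun m₄ h₄ =>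
    Ends.seq (Ends.sub (Ends.branch (fun h9 => Ends.const ?_) fun h9 => Ends.const ?_))
  · simp [PowState, *]
  · obtain ⟨⟨l0, l8, l12, l16, l17⟩, l13⟩ := h₄
    simp only [Function.update_self, l13, l16] at h9
    rw [Function.update_self, if_neg (by omega)]
  · obtain ⟨⟨l0, l8, l12, l16, l17⟩, l13⟩ := h₄
    simp only [Function.update_self, l13, l16] at h9
    rw [Function.update_self, if_pos (by omega)]

lemma agree_sub_disagree {n : ℕ} (Y : Dig n) (i j k : Fin n) :
    (agree (inputOf Y) i j k : ℝ) - disagree (inputOf Y) i j k =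
      ((adj Y i j : SignType) : ℝ) * ((adj Y i k : SignType) : ℝ) := by
  have h : ∀ a b : Fin n, inputOf Y a b = arcCode (adj Y a b) := fun a b => by
    simp [inputOf]
  unfold agree disagree
  rw [h, h]
  rcases adj Y i j with _ | _ | _ <;> rcases adj Y i k with _ | _ | _ <;> simp [arcCode]

lemma value_starPoly_eq_count {n : ℕ} (Y : Dig n) :
    value (starPoly n) Y =
      (cherrySum (agree (inputOf Y)) n : ℝ) - cherrySum (disagree (inputOf Y)) n := by
  have h1 : value (starPoly n) Y = ∑ i, ∑ j, ∑ k, (if k < j then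
      ((adj Y i j : SignType) : ℝ) * ((adj Y i k : SignType) : ℝ) else 0) := by
    simp only [value, starPoly, map_sum]
    refine Finset.sum_congr rfl fun i _ => ?_
    rw [Finset.sum_comm]
    refine Finset.sum_congr rfl fun j _ => Finset.sum_congr rfl fun k _ => ?_
    have h0 : adj Y i i = 0 := by simp [adj]
    by_cases hj : j = i
    · subst hj; simp [h0]
    · by_cases hk : k = i
      · subst hk; simp [h0]
      · by_cases hjk : k < j
        · simp [hj, hk, hjk, mul_comm]
        · simp [hjk]
  rw [h1]
  unfold cherrySum cherrySumBelow
  push_cast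
  simp_rw [← Finset.sum_sub_distrib]
  rw [Finset.sum_range]
  refine Finset.sum_congr rfl fun i _ => ?_
  rw [Finset.sum_range]
  refine Finset.sum_congr rfl fun j _ => ?_
  have h2 : Finset.range (j : ℕ) = (Finset.range n).filter fun k => k < (j : ℕ) := by
    ext k
    have := j.2
    simp only [Finset.mem_range, Finset.mem_filter]
    omega
  rw [h2, Finset.sum_filter, Finset.sum_range]
  refine Finset.sum_congr rfl fun k _ => ?_
  rw [agree_sub_disagree]
  rfl

/-- Comparing a rational power with a difference of natural numbers, in integer arithmetic. -/
lemma rpow_div_le_sub_iff {n a b s d : ℕ} (ha : a ≠ 0) (hb : b ≠ 0) (hs : s ≤ n ^ 3)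
    (hd : d ≤ n ^ 3) :
    (n : ℝ) ^ ((a : ℝ) / b) ≤ (s : ℝ) - d ↔ n ^ a ≤ (s - d) ^ b := by
  have hb' : (0 : ℝ) < b := by exact_mod_cast Nat.pos_of_ne_zero hb
  have ha' : (0 : ℝ) < a := by exact_mod_cast Nat.pos_of_ne_zero ha
  rcases Nat.eq_zero_or_pos n with rfl | hn
  · have hs0 : s = 0 := by simpa using hs
    have hd0 : d = 0 := by simpa using hd
    subst hs0; subst hd0
    simp [Real.zero_rpow (div_pos ha' hb').ne', ha]
  · have hn0 : (0 : ℝ) < n := by exact_mod_cast hn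
    have ht : (0 : ℝ) < (n : ℝ) ^ ((a : ℝ) / b) := by positivity
    rcases le_or_gt d s with h | h
    · have hpow : ((n : ℝ) ^ ((a : ℝ) / b)) ^ b = (n : ℝ) ^ a := by
        rw [← Real.rpow_natCast, ← Real.rpow_mul hn0.le, div_mul_cancel₀ _ hb'.ne',
          Real.rpow_natCast]
      rw [← Nat.cast_sub h, ← pow_le_pow_iff_left₀ ht.le (Nat.cast_nonneg _) hb, hpow]
      exact_mod_cast Iff.rfl
    · have h1 : (s : ℝ) < d := by exact_mod_cast h
      have h2 : s - d = 0 := by omega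
      have h3 : 0 < n ^ a := by positivity
      rw [h2, zero_pow hb]
      constructor
      · intro h4; linarith
      · intro h4; omega

/-- Thresholding the cherry polynomial at a rational power of `n` takes polynomial time. -/
lemma polyTime_thresholdTest {a b : ℕ} (ha : a ≠ 0) (hb : b ≠ 0) :
    PolyTime (thresholdTest starPoly fun n => (n : ℝ) ^ ((a : ℝ) / b)) := by
  refine ⟨thresholdProgram a b, Polynomial.X * (Polynomial.X * (11 * Polynomial.X + 4) + 4) + 11 +
    Polynomial.C b * (3 * Polynomial.X ^ 3 + 4) + Polynomial.C a * (3 * Polynomial.X + 4),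
    fun n Y => ?_⟩
  obtain ⟨m, t, h1, h2, h3⟩ := ends_thresholdProgram (inputOf Y) n a b
  refine ⟨m, t, h1, by simpa using h2, ?_⟩
  have hiff := rpow_div_le_sub_iff (n := n) ha hb
    (cherrySum_le (c := agree (inputOf Y)) (fun i j k => by unfold agree; split_ifs <;> omega) n)
    (cherrySum_le (c := disagree (inputOf Y))
      (fun i j k => by unfold disagree; split_ifs <;> omega) n)
  rw [h3, thresholdTest, value_starPoly_eq_count]
  by_cases h : n ^ a ≤ (cherrySum (agree (inputOf Y)) n - cherrySum (disagree (inputOf Y)) n) ^ b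
  · rw [if_pos h, decide_eq_true (hiff.2 h)]; rfl
  · rw [if_neg h, decide_eq_false fun h' => h (hiff.1 h')]; rfl

end PRS

end

theorem mainTheorem1 (α β γ : ℝ) (hα : α ∈ Set.Ioo (0 : ℝ) 1) (hβ : β ∈ Set.Ioo (0 : ℝ) 1)
    (hγ : γ ∈ Set.Ioo (0 : ℝ) 1) :
    (2 / 3 * α + 1 / 3 * γ + 1 / 2 < β →
      (∀ n, (PRS.starPoly n).totalDegree ≤ 2) ∧
      ∃ t : ℕ → ℝ,
        PRS.PolyTime (PRS.thresholdTest PRS.starPoly t) ∧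
        PRS.StrongDetection (PRS.nullLD γ) (PRS.plantedLD α β γ)
          (PRS.thresholdTest PRS.starPoly t)) ∧
    (β < 2 / 3 * α + 1 / 3 * γ + 1 / 2 →
      ∀ ε : ℝ, 0 < ε → ∀ D : ℕ → ℕ,
        (fun n : ℕ => (D n : ℝ)) =O[atTop] (fun n : ℕ => Real.log (n : ℝ) ^ (2 - ε)) →
        Tendsto (fun n : ℕ => PRS.lowDegAdv (D n) (PRS.nullLD γ n) (PRS.plantedLD α β γ n))
          atTop (𝓝 1) ∧
        ∀ f : ∀ n, PRS.Poly n, (∀ n, (f n).totalDegree ≤ D n) →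
          ¬ PRS.WeaklySeparates (PRS.nullLD γ) (PRS.plantedLD α β γ) f) := by
  refine ⟨fun h => ⟨PRS.totalDegree_starPoly_le, ?_⟩, fun h ε _ D hD =>
    ⟨PRS.tendsto_lowDegAdv hα.1 hβ.2.le hγ.1 h hD, fun f hf =>
      PRS.not_weaklySeparates hα.1 hβ.2.le hγ.1 h hD f hf⟩⟩
  -- The machine works with integer powers, so a rational exponent is needed for the threshold.
  obtain ⟨θ, hlo, hhi⟩ := exists_rat_btwn
    (show 3 / 2 - γ < 3 * β - 2 * γ - 2 * α by linarith)
  have hθ : 0 < θ := by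
    have : (0 : ℝ) < θ := by linarith [hγ.2]
    exact_mod_cast this
  have hnum : 0 < θ.num := Rat.num_pos.2 hθ
  have hcast : (θ : ℝ) = (θ.num.toNat : ℝ) / (θ.den : ℝ) := by
    have h1 : ((θ.num.toNat : ℤ) : ℝ) = (θ.num : ℝ) := by rw [Int.toNat_of_nonneg hnum.le]
    rw [Rat.cast_def, ← h1, Int.cast_natCast]
  rw [hcast] at hlo hhi
  exact ⟨_, PRS.polyTime_thresholdTest (by omega) θ.den_ne_zero,
    PRS.strongDetection_starPoly hα.1 hβ.1 hβ.2.le hγ.1 hlo hhi⟩
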